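/- Let $\mathcal H_A,\mathcal H_B$ be finite-dimensional complex Hilbert spaces with fixed reference orthonormal bases, and equip $\mathcal H_A\otimes\mathcal H_B$ with the product basis. For a bipartite state (density operator) $\rho$ on $\mathcal H_A\otimes\mathcal H_B$ let $\rho^{T_A}$ be its partial transpose with respect to $A$, let $\mathcal N(\rho)=\operatorname{tr}|\rho^{T_A}|-1$ be its negativity, and let $C_{l_1}(\rho)=\sum_{x\neq y}|\rho_{xy}|$ be its $l_1$-norm of coherence in the product basis. Call $\rho$ a pairing state if $\mathcal N(\rho)=C_{l_1}(U\rho U^\dagger)$ for some local unitary $U=U_A\otimes U_B$. Call $\rho$ entangled if it is not a convex combination of product states $\alpha\otimes\beta$, NPT if $\rho^{T_A}$ is not positive semidefinite, and distillable if its distillable entanglement is positive, i.e. if there is a rate $R>0$ such that for every $\varepsilon>0$ and all sufficiently large $n$ there are an integer $K\ge 2^{Rn}$ and a deterministic finite-round protocol $\Lambda$ of local operations and classical communication, mapping states on $\mathcal H_A^{\otimes n}\otimes\mathcal H_B^{\otimes n}$ to states on $\mathbb C^K\otimes\mathbb C^K$, with $\langle\Phi_K|\Lambda(\rho^{\otimes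 n})|\Phi_K\rangle\ge 1-\varepsilon$, where $|\Phi_K\rangle=K^{-1/2}\sum_{j=1}^K|jj\rangle$. Theorem. Every entangled pairing state $\rho$ on $\mathcal H_A\otimes\mathcal H_B$ is NPT and distillable. -/

import Mathlib

open scoped Matrix Kronecker ComplexOrder

namespace Bipartite

noncomputable section

/-- A quantum state (density matrix), written in the reference orthonormal basis indexed by `S`. -/
structure IsState {S : Type} [Fintype S] (ρ : Matrix S S ℂ) : Prop where
  posSemidef : ρ.PosSemidef
  trace_eq_one : ρ.trace = 1

/-- Separable: a finite convex combination of products of local states. -/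
def IsSeparable {A B : Type} [Fintype A] [Fintype B] (ρ : Matrix (A × B) (A × B) ℂ) : Prop :=
  ρ ∈ convexHull ℝ {τ : Matrix (A × B) (A × B) ℂ |
    ∃ (α : Matrix A A ℂ) (β : Matrix B B ℂ), IsState α ∧ IsState β ∧ τ = α ⊗ₖ β}

/-- A bipartite state that is not separable. -/
def IsEntangled {A B : Type} [Fintype A] [Fintype B] (ρ : Matrix (A × B) (A × B) ℂ) : Prop :=
  IsState ρ ∧ ¬ IsSeparable ρ

/-- Partial transpose with respect to the subsystem `A`. -/
def partialTransposeA {A B : Type} (ρ : Matrix (A × B) (A × B) ℂ) : Matrix (A × B) (A × B) ℂ :=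
  Matrix.of fun x y => ρ (y.1, x.2) (x.1, y.2)

/-- Negative partial transpose: `ρ^{T_A}` is not positive semidefinite. -/
def IsNPT {A B : Type} (ρ : Matrix (A × B) (A × B) ℂ) : Prop :=
  ¬ (partialTransposeA ρ).PosSemidef

open scoped MatrixOrder Matrix.Norms.L2Operator in
/-- The trace norm `tr |M|`, where `|M|` is the positive square root of `Mᴴ M`. -/
def traceNorm {S : Type} [Fintype S] [DecidableEq S] (M : Matrix S S ℂ) : ℝ :=
  (CFC.abs M).trace.re

/-- The negativity `tr |ρ^{T_A}| - 1`. -/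
def negativity {A B : Type} [Fintype A] [Fintype B] [DecidableEq A] [DecidableEq B]
    (ρ : Matrix (A × B) (A × B) ℂ) : ℝ :=
  traceNorm (partialTransposeA ρ) - 1

/-- The `l₁`-norm of coherence: the sum of the moduli of the off-diagonal entries. -/
def l1Coherence {S : Type} [Fintype S] [DecidableEq S] (ρ : Matrix S S ℂ) : ℝ :=
  ∑ j, ∑ k, if j ≠ k then ‖ρ j k‖ else 0

/-- A pairing state: a state with `𝒩(ρ) = C_{l₁}(U ρ Uᴴ)` for some local unitary
`U = U_A ⊗ U_B`. -/
def IsPairing {A B : Type} [Fintype A] [Fintype B] [DecidableEq A] [DecidableEq B]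
    (ρ : Matrix (A × B) (A × B) ℂ) : Prop :=
  IsState ρ ∧ ∃ UA ∈ Matrix.unitaryGroup A ℂ, ∃ UB ∈ Matrix.unitaryGroup B ℂ,
    negativity ρ = l1Coherence ((UA ⊗ₖ UB) * ρ * (UA ⊗ₖ UB)ᴴ)

/-- Deterministic transformations implementable by finitely many rounds of local operations and
classical communication. A protocol either stops, or one party performs a local measurement with
Kraus operators `K i`, where `∑ i, (K i)ᴴ * K i = 1`, announces the outcome `i`, and the parties go
on with a protocol that may depend on `i`. The dimension of the measured system may change,
depending on the outcome, so local ancillas and local partial traces are included;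
an instrument with several Kraus operators for one outcome is obtained by
continuing in the same way after each of them. -/
inductive IsLOCC {C D : Type} : {A B : Type} →
    (Matrix (A × B) (A × B) ℂ → Matrix (C × D) (C × D) ℂ) → Prop
  | finish : IsLOCC (A := C) (B := D) fun X => X
  | alice {A B ι : Type} {E : ι → Type} [Fintype A] [Fintype B] [DecidableEq A] [DecidableEq B]
      [Fintype ι] [∀ i, Fintype (E i)]
      (K : ∀ i, Matrix (E i) A ℂ) (hK : ∑ i, (K i)ᴴ * K i = 1)
      (Λ : ∀ i, Matrix (E i × B) (E i × B) ℂ → Matrix (C × D) (C × D) ℂ)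
      (hΛ : ∀ i, IsLOCC (Λ i)) :
      IsLOCC fun X : Matrix (A × B) (A × B) ℂ =>
        ∑ i, Λ i ((K i ⊗ₖ (1 : Matrix B B ℂ)) * X * (K i ⊗ₖ (1 : Matrix B B ℂ))ᴴ)
  | bob {A B ι : Type} {E : ι → Type} [Fintype A] [Fintype B] [DecidableEq A] [DecidableEq B]
      [Fintype ι] [∀ i, Fintype (E i)]
      (K : ∀ i, Matrix (E i) B ℂ) (hK : ∑ i, (K i)ᴴ * K i = 1)
      (Λ : ∀ i, Matrix (A × E i) (A × E i) ℂ → Matrix (C × D) (C × D) ℂ)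
      (hΛ : ∀ i, IsLOCC (Λ i)) :
      IsLOCC fun X : Matrix (A × B) (A × B) ℂ =>
        ∑ i, Λ i (((1 : Matrix A A ℂ) ⊗ₖ K i) * X * ((1 : Matrix A A ℂ) ⊗ₖ K i)ᴴ)

/-- The `n`-copy state `ρ^{⊗ n}`, as a bipartite state between `Aⁿ` and `Bⁿ`. -/
def copies {A B : Type} (ρ : Matrix (A × B) (A × B) ℂ) (n : ℕ) :
    Matrix ((Fin n → A) × (Fin n → B)) ((Fin n → A) × (Fin n → B)) ℂ :=
  Matrix.of fun x y => ∏ t, ρ (x.1 t, x.2 t) (y.1 t, y.2 t)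

/-- The maximally entangled unit vector `K^{-1/2} ∑ j, |j j⟩` of local dimension `K`. -/
def maxEntangled (K : ℕ) : Fin K × Fin K → ℂ :=
  fun x => if x.1 = x.2 then (((√(K : ℝ))⁻¹ : ℝ) : ℂ) else 0

/-- The fidelity `⟨Φ_K| σ |Φ_K⟩` of `σ` with the maximally entangled state. -/
def maxEntangledFidelity {K : ℕ} (σ : Matrix (Fin K × Fin K) (Fin K × Fin K) ℂ) : ℝ :=
  (star (maxEntangled K) ⬝ᵥ (σ *ᵥ maxEntangled K)).re

/-- `R` is an achievable rate (in ebits per copy) of entanglement distillation: from `n` copies of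
`ρ`, LOCC produces a maximally entangled state of local dimension at least `2 ^ (R n)`, with
fidelity tending to one as `n → ∞`. -/
def IsDistillationRate {A B : Type} (ρ : Matrix (A × B) (A × B) ℂ) (R : ℝ) : Prop :=
  ∀ ε : ℝ, 0 < ε → ∀ᶠ n : ℕ in Filter.atTop, ∃ K : ℕ, (2 : ℝ) ^ (R * n) ≤ K ∧
    ∃ Λ : Matrix ((Fin n → A) × (Fin n → B)) ((Fin n → A) × (Fin n → B)) ℂ →
        Matrix (Fin K × Fin K) (Fin K × Fin K) ℂ,
      IsLOCC Λ ∧ 1 - ε ≤ maxEntangledFidelity (Λ (copies ρ n))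

/-- Distillable: some positive rate is achievable, i.e. the distillable entanglement (the supremum
of the achievable rates) is positive. -/
def IsDistillable {A B : Type} (ρ : Matrix (A × B) (A × B) ℂ) : Prop :=
  ∃ R : ℝ, 0 < R ∧ IsDistillationRate ρ R

end

end Bipartite

/-!
The moduli of the entries of `ρ^{T_A}` are those of `ρ`, so a state is a pairing state exactly when,
after a local unitary, the trace norm of its partial transpose equals the sum of the moduli of the
entries. A unitary attaining the trace norm then turns this equality into one in the triangle
inequality: every column of the partial transpose has at most one nonzero entry. Hence a coherence
`ρ (a, b) (a', b') ≠ 0` leaves the levels `(a, b')` and `(a', b)` unpopulated. Such a coherence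
exists for an entangled state, since a diagonal state is separable. In `ρ^{T_A}` it sits next to a
vanishing diagonal entry, which positive semidefiniteness forbids.

The two levels `(a, b)` and `(a', b')` form a pair of qubits that local filtering turns into a
phase-damped Bell pair with a remaining coherence `t > 0`. In the Hadamard basis, `n` such pairs are
a maximally entangled state of `ZMod 2 ^ n` shifted by independent random bits. Measuring the coset
of the shift with respect to the kernel of a random linear map into `ZMod 2 ^ (n - k)` reveals the
shift, up to an error of at most `2 ^ k * ((1 + √(1 - t ^ 2)) / 2) ^ n` by the Bhattacharyya bound,
and leaves at least `k` ebits; the error vanishes as `n → ∞` for `k = ⌈R * n⌉` with `R` small.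
-/

namespace Bipartite

noncomputable section

/-! ### The trace norm and the entrywise `l₁`-norm -/

open scoped MatrixOrder Matrix.Norms.L2Operator in
theorem exists_unitary_traceNorm_eq {S : Type} [Fintype S] [DecidableEq S] {M : Matrix S S ℂ}
    (hM : M.IsHermitian) :
    ∃ s ∈ Matrix.unitaryGroup S ℂ, traceNorm M = (s * M).trace.re := by
  have hM' : IsSelfAdjoint M := hM
  have hcont (f : ℝ → ℝ) : ContinuousOn f (spectrum ℝ M) :=
    Matrix.finite_real_spectrum.continuousOn f
  set sgn : ℝ → ℝ := fun x => if 0 ≤ x then 1 else -1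
  have hsgn_sq : (fun x => sgn x * sgn x) = fun _ => 1 := by
    funext x
    simp only [sgn]
    split_ifs <;> norm_num
  have hsgn_mul : (fun x => sgn x * x) = fun x => ‖x‖ := by
    funext x
    simp only [sgn, Real.norm_eq_abs]
    split_ifs with h
    · rw [abs_of_nonneg h, one_mul]
    · rw [abs_of_neg (not_le.mp h), neg_one_mul]
  refine ⟨cfc sgn M, ?_, ?_⟩
  · rw [Matrix.mem_unitaryGroup_iff, (cfc_predicate sgn M).star_eq,
      ← cfc_mul sgn sgn M (hcont _) (hcont _), hsgn_sq, cfc_const_one ℝ M]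
  · have habs : cfc sgn M * M = CFC.abs M := by
      nth_rewrite 2 [← cfc_id' ℝ M]
      rw [← cfc_mul sgn _ M (hcont _) (hcont _), hsgn_mul, CFC.abs_eq_cfc_norm M hM']
    rw [habs, traceNorm]

open scoped MatrixOrder Matrix.Norms.L2Operator in
theorem traceNorm_unitary_conj {S : Type} [Fintype S] [DecidableEq S] {U : Matrix S S ℂ}
    (hU : U ∈ Matrix.unitaryGroup S ℂ) (M : Matrix S S ℂ) :
    traceNorm (U * M * Uᴴ) = traceNorm M := by
  have hU' : Uᴴ * U = 1 := Matrix.mem_unitaryGroup_iff'.mp hU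
  have hmul (X Y : Matrix S S ℂ) : U * X * Uᴴ * (U * Y * Uᴴ) = U * (X * Y) * Uᴴ := by
    calc U * X * Uᴴ * (U * Y * Uᴴ) = U * X * (Uᴴ * U) * Y * Uᴴ := by
          simp only [Matrix.mul_assoc]
      _ = U * (X * Y) * Uᴴ := by rw [hU', Matrix.mul_one, Matrix.mul_assoc U]
  have hnonneg : 0 ≤ U * CFC.abs M * Uᴴ := Matrix.nonneg_iff_posSemidef.mpr
    ((Matrix.nonneg_iff_posSemidef.mp (CFC.abs_nonneg M)).mul_mul_conjTranspose_same U)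
  have habs : CFC.abs (U * M * Uᴴ) = U * CFC.abs M * Uᴴ := by
    refine CFC.sqrt_unique ?_ hnonneg
    rw [hmul, CFC.abs_mul_abs, ← hmul]
    simp only [Matrix.star_eq_conjTranspose, Matrix.conjTranspose_mul,
      Matrix.conjTranspose_conjTranspose, Matrix.mul_assoc]
  rw [traceNorm, habs, Matrix.trace_mul_cycle, hU', Matrix.one_mul, traceNorm]

section Unitary

variable {S : Type*} [Fintype S] [DecidableEq S] {s X : Matrix S S ℂ}

theorem sum_sq_norm_row_of_mem_unitaryGroup (hs : s ∈ Matrix.unitaryGroup S ℂ) (x : S) :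
    ∑ y, ‖s x y‖ ^ 2 = 1 := by
  have h := congrFun (congrFun (Matrix.mem_unitaryGroup_iff.mp hs) x) x
  simp only [Matrix.mul_apply, Matrix.star_apply, Matrix.one_apply_eq, RCLike.star_def,
    Complex.mul_conj'] at h
  exact_mod_cast h

theorem eq_of_norm_eq_one_of_mem_unitaryGroup (hs : s ∈ Matrix.unitaryGroup S ℂ) {x y y' : S}
    (hy : ‖s x y‖ = 1) (hy' : ‖s x y'‖ = 1) : y = y' := by
  by_contra hne
  have h := Finset.add_le_sum (f := fun y => ‖s x y‖ ^ 2) (fun _ _ => by positivity)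
    (Finset.mem_univ y) (Finset.mem_univ y') hne
  rw [sum_sq_norm_row_of_mem_unitaryGroup hs x] at h
  norm_num [hy, hy'] at h

theorem norm_eq_one_of_trace_mul_eq_sum_norm (hs : s ∈ Matrix.unitaryGroup S ℂ)
    (h : (s * X).trace.re = ∑ x, ∑ y, ‖X y x‖) {x y : S} (hxy : X y x ≠ 0) : ‖s x y‖ = 1 := by
  have hs_le := entry_norm_bound_of_unitary hs
  have hterm (x y : S) : (s x y * X y x).re ≤ ‖X y x‖ :=
    calc (s x y * X y x).re ≤ ‖s x y‖ * ‖X y x‖ := norm_mul (s x y) _ ▸ Complex.re_le_norm _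
      _ ≤ ‖X y x‖ := mul_le_of_le_one_left (norm_nonneg _) (hs_le x y)
  have htrace : ∑ x, ∑ y, (s x y * X y x).re = ∑ x, ∑ y, ‖X y x‖ := by
    simp only [← h, Matrix.trace, Matrix.diag_apply, Matrix.mul_apply, Complex.re_sum]
  have heq : (s x y * X y x).re = ‖X y x‖ := by
    have hrow := (Finset.sum_eq_sum_iff_of_le fun x _ =>
      Finset.sum_le_sum fun y _ => hterm x y).mp htrace x (Finset.mem_univ x)
    exact (Finset.sum_eq_sum_iff_of_le fun y _ => hterm x y).mp hrow y (Finset.mem_univ y)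
  have hle : ‖X y x‖ ≤ ‖s x y‖ * ‖X y x‖ := by
    rw [← norm_mul, ← heq]
    exact Complex.re_le_norm _
  exact (hs_le x y).antisymm (le_of_mul_le_mul_right (by linarith) (norm_pos_iff.mpr hxy))

end Unitary

theorem column_subsingleton_of_traceNorm_eq {S : Type} [Fintype S] [DecidableEq S]
    {M : Matrix S S ℂ} (hM : M.IsHermitian) (h : traceNorm M = ∑ x, ∑ y, ‖M y x‖) {x y y' : S}
    (hy : M y x ≠ 0) (hy' : M y' x ≠ 0) : y = y' := by
  obtain ⟨s, hs, htrace⟩ := exists_unitary_traceNorm_eq hM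
  have hone {y : S} : M y x ≠ 0 → ‖s x y‖ = 1 :=
    norm_eq_one_of_trace_mul_eq_sum_norm hs (htrace.symm.trans h)
  exact eq_of_norm_eq_one_of_mem_unitaryGroup hs (hone hy) (hone hy')

section PosSemidef

variable {S : Type*} {M : Matrix S S ℂ}

theorem norm_sq_apply_le_of_posSemidef (hM : M.PosSemidef) (x y : S) :
    ‖M x y‖ ^ 2 ≤ (M x x).re * (M y y).re := by
  have hdet : 0 ≤ (M.submatrix ![x, y] ![x, y]).det := (hM.submatrix ![x, y]).det_nonneg
  have hyx : M y x = star (M x y) := (hM.isHermitian.apply y x).symm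
  have hx : ((M x x).re : ℂ) = M x x := hM.isHermitian.coe_re_apply_self x
  have hy : ((M y y).re : ℂ) = M y y := hM.isHermitian.coe_re_apply_self y
  rw [Matrix.det_fin_two] at hdet
  simp only [Matrix.submatrix_apply, Matrix.cons_val_zero, Matrix.cons_val_one, hyx,
    RCLike.star_def, Complex.mul_conj'] at hdet
  rw [← hx, ← hy] at hdet
  exact sub_nonneg.mp (by exact_mod_cast hdet)

theorem apply_eq_zero_of_posSemidef_of_diag_left (hM : M.PosSemidef) {x : S} (hx : M x x = 0)
    (y : S) : M x y = 0 := by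
  have h := norm_sq_apply_le_of_posSemidef hM x y
  rw [hx, Complex.zero_re, zero_mul] at h
  exact norm_eq_zero.mp (pow_eq_zero_iff two_ne_zero |>.mp (h.antisymm (sq_nonneg _)))

theorem apply_eq_zero_of_posSemidef_of_diag_right (hM : M.PosSemidef) {y : S} (hy : M y y = 0)
    (x : S) : M x y = 0 := by
  rw [← hM.isHermitian.apply, apply_eq_zero_of_posSemidef_of_diag_left hM hy, star_zero]

end PosSemidef

/-! ### Local operators acting on bipartite matrices -/

section LocalConj

variable {A A' A'' B B' B'' : Type*} [Fintype A] [Fintype B]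

/-- The unnormalized local operation `X ↦ (K ⊗ L) X (K ⊗ L)ᴴ`, bundled as a linear map so that
it commutes with sums and scalar multiples. -/
def localConj (K : Matrix A' A ℂ) (L : Matrix B' B ℂ) :
    Matrix (A × B) (A × B) ℂ →ₗ[ℂ] Matrix (A' × B') (A' × B') ℂ where
  toFun X := (K ⊗ₖ L) * X * (K ⊗ₖ L)ᴴ
  map_add' X Y := by rw [Matrix.mul_add, Matrix.add_mul]
  map_smul' c X := by rw [Matrix.mul_smul, Matrix.smul_mul, RingHom.id_apply]

theorem localConj_apply (K : Matrix A' A ℂ) (L : Matrix B' B ℂ) (X : Matrix (A × B) (A × B) ℂ) :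
    localConj K L X = (K ⊗ₖ L) * X * (K ⊗ₖ L)ᴴ :=
  rfl

theorem localConj_apply_apply (K : Matrix A' A ℂ) (L : Matrix B' B ℂ)
    (X : Matrix (A × B) (A × B) ℂ) (x y : A' × B') :
    localConj K L X x y =
      ∑ i, ∑ j, K x.1 i.1 * L x.2 i.2 * X i j * star (K y.1 j.1 * L y.2 j.2) := by
  simp only [localConj_apply, Matrix.mul_apply, Matrix.conjTranspose_apply,
    Matrix.kroneckerMap_apply, Finset.sum_mul]
  exact Finset.sum_comm

@[simp]
theorem localConj_one [DecidableEq A] [DecidableEq B] (X : Matrix (A × B) (A × B) ℂ) :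
    localConj 1 1 X = X := by
  rw [localConj_apply, Matrix.one_kronecker_one, Matrix.conjTranspose_one, Matrix.one_mul,
    Matrix.mul_one]

theorem localConj_localConj [Fintype A'] [Fintype B'] (K' : Matrix A'' A' ℂ)
    (L' : Matrix B'' B' ℂ) (K : Matrix A' A ℂ) (L : Matrix B' B ℂ)
    (X : Matrix (A × B) (A × B) ℂ) :
    localConj K' L' (localConj K L X) = localConj (K' * K) (L' * L) X := by
  simp only [localConj_apply, Matrix.mul_kronecker_mul, Matrix.conjTranspose_mul,
    Matrix.mul_assoc]

theorem trace_localConj [Fintype A'] [Fintype B'] (K : Matrix A' A ℂ) (L : Matrix B' B ℂ)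
    (X : Matrix (A × B) (A × B) ℂ) :
    (localConj K L X).trace = (((Kᴴ * K) ⊗ₖ (Lᴴ * L)) * X).trace := by
  rw [localConj_apply, Matrix.trace_mul_cycle, Matrix.conjTranspose_kronecker,
    ← Matrix.mul_kronecker_mul]

theorem localConj_kronecker (K : Matrix A' A ℂ) (L : Matrix B' B ℂ) (α : Matrix A A ℂ)
    (β : Matrix B B ℂ) : localConj K L (α ⊗ₖ β) = (K * α * Kᴴ) ⊗ₖ (L * β * Lᴴ) := by
  rw [localConj_apply, Matrix.conjTranspose_kronecker, ← Matrix.mul_kronecker_mul,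
    ← Matrix.mul_kronecker_mul]

theorem posSemidef_localConj {X : Matrix (A × B) (A × B) ℂ} [Finite A'] [Finite B']
    (hX : X.PosSemidef) (K : Matrix A' A ℂ) (L : Matrix B' B ℂ) : (localConj K L X).PosSemidef :=
  hX.mul_mul_conjTranspose_same (K ⊗ₖ L)

end LocalConj

section PartialTranspose

variable {A B : Type} {ρ : Matrix (A × B) (A × B) ℂ}

theorem isHermitian_partialTransposeA (hρ : ρ.IsHermitian) :
    (partialTransposeA ρ).IsHermitian :=
  Matrix.IsHermitian.ext fun _ _ => hρ.apply _ _

theorem sum_norm_partialTransposeA [Fintype A] [Fintype B] (ρ : Matrix (A × B) (A × B) ℂ) :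
    ∑ x, ∑ y, ‖partialTransposeA ρ y x‖ = ∑ x, ∑ y, ‖ρ x y‖ := by
  simp only [← Fintype.sum_prod_type']
  exact Fintype.sum_equiv
    ⟨fun p => ((p.1.1, p.2.2), (p.2.1, p.1.2)), fun p => ((p.1.1, p.2.2), (p.2.1, p.1.2)),
      fun _ => rfl, fun _ => rfl⟩ _ _ fun _ => rfl

theorem partialTransposeA_localConj {A' B' : Type} [Fintype A] [Fintype B] (K : Matrix A' A ℂ)
    (L : Matrix B' B ℂ) (ρ : Matrix (A × B) (A × B) ℂ) :
    partialTransposeA (localConj K L ρ) = localConj (K.map star) L (partialTransposeA ρ) := by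
  ext x y
  rw [localConj_apply_apply, partialTransposeA, Matrix.of_apply, localConj_apply_apply]
  simp only [← Fintype.sum_prod_type', Matrix.map_apply]
  refine Fintype.sum_equiv
    ⟨fun p => ((p.2.1, p.1.2), (p.1.1, p.2.2)), fun p => ((p.2.1, p.1.2), (p.1.1, p.2.2)),
      fun _ => rfl, fun _ => rfl⟩ _ _ fun p => ?_
  simp only [partialTransposeA, Matrix.of_apply, Equiv.coe_fn_mk, star_mul', star_star]
  ring

end PartialTranspose

section State

variable {S : Type} [Fintype S] {ρ : Matrix S S ℂ}

theorem IsState.ofReal_norm_apply_self (hρ : IsState ρ) (x : S) : (‖ρ x x‖ : ℂ) = ρ x x :=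
  Complex.norm_of_nonneg' hρ.posSemidef.diag_nonneg

theorem IsState.sum_norm_diag (hρ : IsState ρ) : ∑ x, ‖ρ x x‖ = 1 := by
  have h : ∑ x, (‖ρ x x‖ : ℂ) = 1 := by
    rw [← hρ.trace_eq_one]
    exact Finset.sum_congr rfl fun x _ => hρ.ofReal_norm_apply_self x
  exact_mod_cast h

theorem IsState.sum_norm_eq [DecidableEq S] (hρ : IsState ρ) :
    ∑ x, ∑ y, ‖ρ x y‖ = 1 + l1Coherence ρ := by
  rw [← hρ.sum_norm_diag, l1Coherence, ← Finset.sum_add_distrib]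
  refine Finset.sum_congr rfl fun x _ => ?_
  rw [← Finset.sum_filter, Finset.filter_ne, Finset.add_sum_erase _ (‖ρ x ·‖) (Finset.mem_univ x)]

theorem IsState.unitary_conj [DecidableEq S] (hρ : IsState ρ) {U : Matrix S S ℂ}
    (hU : U ∈ Matrix.unitaryGroup S ℂ) : IsState (U * ρ * Uᴴ) where
  posSemidef := hρ.posSemidef.mul_mul_conjTranspose_same U
  trace_eq_one := by
    rw [Matrix.trace_mul_cycle, ← Matrix.star_eq_conjTranspose,
      Matrix.mem_unitaryGroup_iff'.mp hU, Matrix.one_mul, hρ.trace_eq_one]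

theorem isState_single [DecidableEq S] (a : S) : IsState (Matrix.single a a (1 : ℂ)) where
  posSemidef := by
    rw [← Matrix.diagonal_single]
    exact Matrix.PosSemidef.diagonal (Pi.single_nonneg.mpr zero_le_one)
  trace_eq_one := Matrix.trace_single_eq_same a 1

end State

section LocalUnitary

variable {A B : Type} [Fintype A] [Fintype B] {ρ : Matrix (A × B) (A × B) ℂ}

theorem isSeparable_of_isDiag (hρ : IsState ρ) (hd : ρ.IsDiag) : IsSeparable ρ := by
  classical
  have hsum : ρ = ∑ x, ‖ρ x x‖ • Matrix.single x x (1 : ℂ) := by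
    simp_rw [Matrix.smul_single, Complex.real_smul, mul_one, hρ.ofReal_norm_apply_self]
    rw [Matrix.sum_single_eq_diagonal]
    exact hd.diagonal_diag.symm
  rw [hsum]
  refine (convex_convexHull ℝ _).sum_mem (fun _ _ => norm_nonneg _) hρ.sum_norm_diag fun x _ =>
    subset_convexHull ℝ _ ⟨_, _, isState_single x.1, isState_single x.2, ?_⟩
  rw [Matrix.single_kronecker_single, one_mul]

theorem isNPT_of_isNPT_localConj {A' B' : Type} [Finite A'] [Finite B'] {K : Matrix A' A ℂ}
    {L : Matrix B' B ℂ} (h : IsNPT (localConj K L ρ)) : IsNPT ρ := fun hρ =>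
  h (partialTransposeA_localConj K L ρ ▸ posSemidef_localConj hρ _ _)

variable [DecidableEq A] [DecidableEq B] {UA : Matrix A A ℂ} {UB : Matrix B B ℂ}

theorem localConj_star_localConj (hA : UA ∈ Matrix.unitaryGroup A ℂ)
    (hB : UB ∈ Matrix.unitaryGroup B ℂ) (ρ : Matrix (A × B) (A × B) ℂ) :
    localConj (star UA) (star UB) (localConj UA UB ρ) = ρ := by
  rw [localConj_localConj, Matrix.mem_unitaryGroup_iff'.mp hA, Matrix.mem_unitaryGroup_iff'.mp hB,
    localConj_one]

theorem IsState.localConj (hρ : IsState ρ) (hA : UA ∈ Matrix.unitaryGroup A ℂ)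
    (hB : UB ∈ Matrix.unitaryGroup B ℂ) : IsState (localConj UA UB ρ) :=
  hρ.unitary_conj (Matrix.kronecker_mem_unitary hA hB)

theorem IsSeparable.localConj (hρ : IsSeparable ρ) (hA : UA ∈ Matrix.unitaryGroup A ℂ)
    (hB : UB ∈ Matrix.unitaryGroup B ℂ) : IsSeparable (localConj UA UB ρ) := by
  have hconv : Convex ℝ {τ | IsSeparable (Bipartite.localConj UA UB τ)} :=
    (convex_convexHull ℝ _).is_linear_preimage
      ((Bipartite.localConj UA UB).restrictScalars ℝ).isLinear
  refine convexHull_min ?_ hconv hρ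
  rintro _ ⟨α, β, hα, hβ, rfl⟩
  rw [Set.mem_ofPred_eq, localConj_kronecker]
  exact subset_convexHull ℝ _ ⟨_, _, hα.unitary_conj hA, hβ.unitary_conj hB, rfl⟩

theorem negativity_localConj (hA : UA ∈ Matrix.unitaryGroup A ℂ)
    (hB : UB ∈ Matrix.unitaryGroup B ℂ) (ρ : Matrix (A × B) (A × B) ℂ) :
    negativity (localConj UA UB ρ) = negativity ρ := by
  rw [negativity, partialTransposeA_localConj, localConj_apply, traceNorm_unitary_conj, negativity]
  exact Matrix.kronecker_mem_unitary (Matrix.map_star_mem_unitaryGroup_iff.mpr hA) hB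

end LocalUnitary

section Coherence

variable {A B : Type} {σ : Matrix (A × B) (A × B) ℂ}

theorem apply_swap_eq_zero_of_negativity_eq_l1Coherence [Fintype A] [Fintype B] [DecidableEq A]
    [DecidableEq B] (hσ : IsState σ) (h : negativity σ = l1Coherence σ) {a a' : A} {b b' : B}
    (hne : (a, b) ≠ (a', b')) (hcoh : σ (a, b) (a', b') ≠ 0) :
    σ (a, b') (a, b') = 0 ∧ σ (a', b) (a', b) = 0 := by
  have hherm := isHermitian_partialTransposeA hσ.posSemidef.isHermitian
  have hnorm : traceNorm (partialTransposeA σ) = ∑ x, ∑ y, ‖partialTransposeA σ y x‖ := by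
    rw [sum_norm_partialTransposeA, hσ.sum_norm_eq, ← h, negativity, add_sub_cancel]
  have hne' : (a', b) ≠ (a, b') := fun hab => hne (by simp_all only [Prod.mk.injEq])
  have hcoh' : partialTransposeA σ (a', b) (a, b') ≠ 0 := hcoh
  have hcoh'' : partialTransposeA σ (a, b') (a', b) ≠ 0 := by
    rw [← hherm.apply]
    exact star_ne_zero.mpr hcoh'
  constructor <;> by_contra hpop
  · exact hne' (column_subsingleton_of_traceNorm_eq hherm hnorm (x := (a, b')) hcoh' hpop)
  · exact hne' (column_subsingleton_of_traceNorm_eq hherm hnorm (x := (a', b)) hpop hcoh'')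

theorem isNPT_of_apply_ne_zero {a a' : A} {b b' : B} (hcoh : σ (a, b) (a', b') ≠ 0)
    (hpop : σ (a', b) (a', b) = 0) : IsNPT σ := fun h =>
  hcoh (apply_eq_zero_of_posSemidef_of_diag_left h (x := (a', b)) hpop (a, b'))

end Coherence

/-! ### Closure properties of LOCC transformations -/

section Closure

variable {A B C D E F : Type} {Λ : Matrix (A × B) (A × B) ℂ → Matrix (C × D) (C × D) ℂ}

theorem IsLOCC.exists_linearMap (h : IsLOCC Λ) :
    ∃ f : Matrix (A × B) (A × B) ℂ →ₗ[ℂ] Matrix (C × D) (C × D) ℂ, ⇑f = Λ := by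
  induction h with
  | finish => exact ⟨LinearMap.id, rfl⟩
  | alice K _ Λ _ ih =>
    choose f hf using ih
    refine ⟨∑ i, f i ∘ₗ localConj (K i) 1, funext fun X => ?_⟩
    simp only [LinearMap.sum_apply, LinearMap.comp_apply, hf, localConj_apply]
  | bob K _ Λ _ ih =>
    choose f hf using ih
    refine ⟨∑ i, f i ∘ₗ localConj 1 (K i), funext fun X => ?_⟩
    simp only [LinearMap.sum_apply, LinearMap.comp_apply, hf, localConj_apply]

theorem IsLOCC.comp {Λ' : Matrix (C × D) (C × D) ℂ → Matrix (E × F) (E × F) ℂ} (h' : IsLOCC Λ')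
    (h : IsLOCC Λ) : IsLOCC fun X => Λ' (Λ X) := by
  obtain ⟨f, rfl⟩ := h'.exists_linearMap
  induction h with
  | finish => exact h'
  | alice K hK Λ _ ih =>
    simp only [map_sum]
    exact IsLOCC.alice K hK (fun i X => f (Λ i X)) ih
  | bob K hK Λ _ ih =>
    simp only [map_sum]
    exact IsLOCC.bob K hK (fun i X => f (Λ i X)) ih

theorem convex_setOf_isLOCC [Finite A] [Finite B] :
    Convex ℝ {Λ : Matrix (A × B) (A × B) ℂ → Matrix (C × D) (C × D) ℂ | IsLOCC Λ} := by
  classical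
  cases nonempty_fintype A
  cases nonempty_fintype B
  intro Λ₀ h₀ Λ₁ h₁ p q hp hq hpq
  obtain ⟨f, rfl⟩ := IsLOCC.exists_linearMap h₀
  obtain ⟨g, rfl⟩ := IsLOCC.exists_linearMap h₁
  have hsq {r : ℝ} (hr : 0 ≤ r) : ((√r : ℝ) : ℂ) * (√r : ℝ) = r := by
    rw [← Complex.ofReal_mul, Real.mul_self_sqrt hr]
  have hpq' : (p : ℂ) + q = 1 := by exact_mod_cast hpq
  have hconj {r : ℝ} (hr : 0 ≤ r) (X : Matrix (A × B) (A × B) ℂ) :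
      localConj (((√r : ℝ) : ℂ) • (1 : Matrix A A ℂ)) (1 : Matrix B B ℂ) X = (r : ℂ) • X := by
    rw [localConj_apply, Matrix.smul_kronecker, Matrix.one_kronecker_one,
      Matrix.conjTranspose_smul, Matrix.conjTranspose_one, Matrix.smul_mul, Matrix.one_mul,
      Matrix.mul_smul, Matrix.mul_one, smul_smul, RCLike.star_def, Complex.conj_ofReal, hsq hr]
  have h := IsLOCC.alice (A := A) (B := B)
    (fun i : Fin 2 => ((√(![p, q] i) : ℝ) : ℂ) • (1 : Matrix A A ℂ))
    (by
      simp only [Fin.sum_univ_two, Matrix.cons_val_zero, Matrix.cons_val_one,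
        Matrix.conjTranspose_smul, Matrix.conjTranspose_one, Matrix.smul_mul, Matrix.mul_smul,
        Matrix.one_mul, smul_smul, RCLike.star_def, Complex.conj_ofReal, hsq hp, hsq hq,
        ← add_smul, hpq', one_smul])
    ![f, g] (Fin.forall_fin_two.mpr ⟨h₀, h₁⟩)
  simp only [Fin.sum_univ_two, Matrix.cons_val_zero, Matrix.cons_val_one, ← localConj_apply,
    hconj hp, hconj hq, map_smul] at h
  exact h

theorem isLOCC_localConj [Fintype A] [Fintype B] [DecidableEq A] [DecidableEq B] [Fintype E]
    [Fintype F] {K : Matrix E A ℂ} (hK : Kᴴ * K = 1)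
    {L : Matrix F B ℂ} (hL : Lᴴ * L = 1) :
    IsLOCC (localConj K L : Matrix (A × B) (A × B) ℂ → Matrix (E × F) (E × F) ℂ) := by
  classical
  have hbob : IsLOCC (localConj (1 : Matrix E E ℂ) L) := by
    have h := IsLOCC.bob (A := E) (ι := Unit) (fun _ => L)
      ((Fintype.sum_unique _).trans hL) _ fun _ => IsLOCC.finish
    simp only [Fintype.sum_unique] at h
    exact h
  have h := IsLOCC.alice (B := B) (ι := Unit) (fun _ => K)
    ((Fintype.sum_unique _).trans hK) _ fun _ => hbob
  simpa only [Fintype.sum_unique, ← localConj_apply, localConj_localConj, Matrix.one_mul,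
    Matrix.mul_one] using h

end Closure

section Selection

/-- The operator sending the basis vector `f e` to the sum of the basis vectors indexed by the
fibre of `f` through `e`, and the basis vectors outside the range of `f` to zero. -/
def selection {A E : Type*} [DecidableEq A] (f : E → A) : Matrix E A ℂ :=
  (1 : Matrix A A ℂ).submatrix f id

theorem conjTranspose_selection_mul_selection {A E : Type*} [DecidableEq A] [Fintype E]
    (f : E → A) : (selection f)ᴴ * selection f = ∑ e, Matrix.single (f e) (f e) 1 := by
  ext a a'
  simp only [selection, Matrix.mul_apply, Matrix.sum_apply, Matrix.conjTranspose_apply,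
    Matrix.submatrix_apply, id, Matrix.one_apply, Matrix.single_apply]
  refine Finset.sum_congr rfl fun e _ => ?_
  by_cases h : f e = a <;> by_cases h' : f e = a' <;> simp [h, h']

theorem selection_mul_conjTranspose_selection {A E : Type*} [Fintype A] [DecidableEq A]
    [DecidableEq E] {f : E → A} (hf : Function.Injective f) : selection f * (selection f)ᴴ = 1 := by
  rw [selection, Matrix.conjTranspose_submatrix, Matrix.conjTranspose_one,
    ← Matrix.submatrix_mul _ _ _ _ _ Function.bijective_id, Matrix.one_mul,
    Matrix.submatrix_one f hf]

variable {A B E F : Type}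

theorem localConj_selection [Fintype A] [Fintype B] [DecidableEq A] [DecidableEq B] (f : E → A)
    (g : F → B) (X : Matrix (A × B) (A × B) ℂ) :
    localConj (selection f) (selection g) X = X.submatrix (Prod.map f g) (Prod.map f g) := by
  ext x y
  have h (K : Matrix A A ℂ) (L : Matrix B B ℂ) :
      localConj (K.submatrix f id) (L.submatrix g id) X =
        (localConj K L X).submatrix (Prod.map f g) (Prod.map f g) := rfl
  rw [selection, selection, h, localConj_one]

theorem isLOCC_submatrix [Finite A] [Finite B] (f : E ≃ A) (g : F ≃ B) :
    IsLOCC fun X : Matrix (A × B) (A × B) ℂ => X.submatrix (Prod.map f g) (Prod.map f g) := by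
  classical
  cases nonempty_fintype A
  cases nonempty_fintype B
  have := Fintype.ofEquiv A f.symm
  have := Fintype.ofEquiv B g.symm
  have hisometry {G H : Type} [Fintype G] [Fintype H] [DecidableEq H] (f : G ≃ H) :
      (selection f)ᴴ * selection f = 1 := by
    rw [conjTranspose_selection_mul_selection, f.sum_comp fun a => Matrix.single a a (1 : ℂ),
      Matrix.sum_single_one]
  have h := isLOCC_localConj (hisometry f) (hisometry g)
  simpa only [funext (localConj_selection f g)] using h

end Selection

section Tensor

/-- The product of two bipartite matrices, as a bipartite matrix between the two `A`-systems and
the two `B`-systems. -/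
def tensor {A B A' B' : Type*} (X : Matrix (A × B) (A × B) ℂ)
    (Y : Matrix (A' × B') (A' × B') ℂ) : Matrix ((A × A') × (B × B')) ((A × A') × (B × B')) ℂ :=
  (X ⊗ₖ Y).submatrix (Equiv.prodProdProdComm A A' B B') (Equiv.prodProdProdComm A A' B B')

theorem sum_tensor {A B A' B' ι : Type*} [Fintype ι] (X : ι → Matrix (A × B) (A × B) ℂ)
    (Y : Matrix (A' × B') (A' × B') ℂ) : tensor (∑ i, X i) Y = ∑ i, tensor (X i) Y := by
  ext x y
  simp only [tensor, Matrix.submatrix_apply, Matrix.kroneckerMap_apply, Matrix.sum_apply,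
    Finset.sum_mul]

theorem tensor_submatrix_swap {A B A' B' : Type*} (X : Matrix (A × B) (A × B) ℂ)
    (Y : Matrix (A' × B') (A' × B') ℂ) :
    (tensor X Y).submatrix (Prod.map (Equiv.prodComm A' A) (Equiv.prodComm B' B))
      (Prod.map (Equiv.prodComm A' A) (Equiv.prodComm B' B)) = tensor Y X := by
  ext x y
  exact mul_comm _ _

theorem localConj_tensor {A B A' B' C D C' D' : Type*} [Fintype A] [Fintype B] [Fintype A']
    [Fintype B'] (K : Matrix C A ℂ) (K' : Matrix C' A' ℂ) (L : Matrix D B ℂ) (L' : Matrix D' B' ℂ)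
    (X : Matrix (A × B) (A × B) ℂ) (Y : Matrix (A' × B') (A' × B') ℂ) :
    localConj (K ⊗ₖ K') (L ⊗ₖ L') (tensor X Y) = tensor (localConj K L X) (localConj K' L' Y) := by
  have h : (K ⊗ₖ K') ⊗ₖ (L ⊗ₖ L') = ((K ⊗ₖ L) ⊗ₖ (K' ⊗ₖ L')).submatrix
      (Equiv.prodProdProdComm C C' D D') (Equiv.prodProdProdComm A A' B B') := by
    ext x y
    exact mul_mul_mul_comm _ _ _ _
  simp only [localConj_apply, tensor, h, Matrix.conjTranspose_submatrix,
    Matrix.submatrix_mul_equiv, Matrix.conjTranspose_kronecker, ← Matrix.mul_kronecker_mul]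

variable {A B C D A' B' C' D' : Type}
  {Λ : Matrix (A × B) (A × B) ℂ → Matrix (C × D) (C × D) ℂ}
  {Λ' : Matrix (A' × B') (A' × B') ℂ → Matrix (C' × D') (C' × D') ℂ}

theorem sum_conjTranspose_kronecker_one_mul [Fintype A'] [DecidableEq A] [DecidableEq A']
    {ι : Type*} [Fintype ι] {E : ι → Type*} [∀ i, Fintype (E i)] {K : ∀ i, Matrix (E i) A ℂ}
    (hK : ∑ i, (K i)ᴴ * K i = 1) :
    ∑ i, (K i ⊗ₖ (1 : Matrix A' A' ℂ))ᴴ * (K i ⊗ₖ (1 : Matrix A' A' ℂ)) = 1 := by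
  have hterm (i : ι) : (K i ⊗ₖ (1 : Matrix A' A' ℂ))ᴴ * (K i ⊗ₖ (1 : Matrix A' A' ℂ)) =
      ((K i)ᴴ * K i) ⊗ₖ (1 : Matrix A' A' ℂ) := by
    rw [Matrix.conjTranspose_kronecker, ← Matrix.mul_kronecker_mul, Matrix.conjTranspose_one,
      Matrix.one_mul]
  rw [Finset.sum_congr rfl fun i _ => hterm i, ← Matrix.one_kronecker_one, ← hK]
  ext x y
  simp only [Matrix.sum_apply, Matrix.kroneckerMap_apply, Finset.sum_mul]

theorem IsLOCC.exists_tensor_id [Finite A'] [Finite B'] (h : IsLOCC Λ) :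
    ∃ Λ₁ : Matrix ((A × A') × (B × B')) ((A × A') × (B × B')) ℂ →
        Matrix ((C × A') × (D × B')) ((C × A') × (D × B')) ℂ,
      IsLOCC Λ₁ ∧ ∀ X Y, Λ₁ (tensor X Y) = tensor (Λ X) Y := by
  classical
  cases nonempty_fintype A'
  cases nonempty_fintype B'
  induction h with
  | finish => exact ⟨_, IsLOCC.finish, fun _ _ => rfl⟩
  | alice K hK Λ _ ih =>
    choose Λ₁ hΛ₁ hext using ih
    refine ⟨_, IsLOCC.alice _ (sum_conjTranspose_kronecker_one_mul hK) Λ₁ hΛ₁, fun X Y => ?_⟩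
    simp only [← localConj_apply, sum_tensor, ← hext]
    simp only [← Matrix.one_kronecker_one, localConj_tensor, localConj_one]
  | bob K hK Λ _ ih =>
    choose Λ₁ hΛ₁ hext using ih
    refine ⟨_, IsLOCC.bob _ (sum_conjTranspose_kronecker_one_mul hK) Λ₁ hΛ₁, fun X Y => ?_⟩
    simp only [← localConj_apply, sum_tensor, ← hext]
    simp only [← Matrix.one_kronecker_one, localConj_tensor, localConj_one]

theorem IsLOCC.exists_tensor [Finite A'] [Finite B'] [Finite C] [Finite D] [Finite C']
    [Finite D'] (h : IsLOCC Λ) (h' : IsLOCC Λ') :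
    ∃ Λ₂ : Matrix ((A × A') × (B × B')) ((A × A') × (B × B')) ℂ →
        Matrix ((C × C') × (D × D')) ((C × C') × (D × D')) ℂ,
      IsLOCC Λ₂ ∧ ∀ X Y, Λ₂ (tensor X Y) = tensor (Λ X) (Λ' Y) := by
  obtain ⟨Λ₁, hΛ₁, hext⟩ := h.exists_tensor_id (A' := A') (B' := B')
  obtain ⟨Λ₁', hΛ₁', hext'⟩ := h'.exists_tensor_id (A' := C) (B' := D)
  have hswap := isLOCC_submatrix (Equiv.prodComm A' C) (Equiv.prodComm B' D)
  have hswap' := isLOCC_submatrix (Equiv.prodComm C C') (Equiv.prodComm D D')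
  refine ⟨_, hswap'.comp (hΛ₁'.comp (hswap.comp hΛ₁)), fun X Y => ?_⟩
  rw [hext, tensor_submatrix_swap, hext', tensor_submatrix_swap]

theorem copies_succ_submatrix (ρ : Matrix (A × B) (A × B) ℂ) (n : ℕ) :
    (copies ρ (n + 1)).submatrix
      (Prod.map (Fin.consEquiv fun _ => A) (Fin.consEquiv fun _ => B))
      (Prod.map (Fin.consEquiv fun _ => A) (Fin.consEquiv fun _ => B)) =
        tensor ρ (copies ρ n) := by
  ext x y
  simp [copies, tensor, Fin.prod_univ_succ, Fin.consEquiv]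

theorem tensor_copies_submatrix (ρ : Matrix (A × B) (A × B) ℂ) (n : ℕ) :
    (tensor ρ (copies ρ n)).submatrix
      (Prod.map (Fin.consEquiv fun _ => A).symm (Fin.consEquiv fun _ => B).symm)
      (Prod.map (Fin.consEquiv fun _ => A).symm (Fin.consEquiv fun _ => B).symm) =
        copies ρ (n + 1) := by
  rw [← copies_succ_submatrix, Matrix.submatrix_submatrix, Prod.map_comp_map,
    Equiv.self_comp_symm, Equiv.self_comp_symm, Prod.map_id, Matrix.submatrix_id_id]

theorem IsLOCC.exists_copies [Finite A] [Finite B] [Finite C] [Finite D] (h : IsLOCC Λ)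
    (n : ℕ) :
    ∃ Λ₁ : Matrix ((Fin n → A) × (Fin n → B)) ((Fin n → A) × (Fin n → B)) ℂ →
        Matrix ((Fin n → C) × (Fin n → D)) ((Fin n → C) × (Fin n → D)) ℂ,
      IsLOCC Λ₁ ∧ ∀ ρ, Λ₁ (copies ρ n) = copies (Λ ρ) n := by
  induction n with
  | zero =>
    refine ⟨_, isLOCC_submatrix (Equiv.ofUnique (Fin 0 → C) (Fin 0 → A))
      (Equiv.ofUnique (Fin 0 → D) (Fin 0 → B)), fun ρ => ?_⟩
    ext x y
    simp [copies]
  | succ n ih =>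
    obtain ⟨Λ₁, hΛ₁, hcopies⟩ := ih
    obtain ⟨Λ₂, hΛ₂, htensor⟩ := h.exists_tensor hΛ₁
    have hsplit := isLOCC_submatrix (Fin.consEquiv fun _ : Fin (n + 1) => A)
      (Fin.consEquiv fun _ : Fin (n + 1) => B)
    have hmerge := isLOCC_submatrix (Fin.consEquiv fun _ : Fin (n + 1) => C).symm
      (Fin.consEquiv fun _ : Fin (n + 1) => D).symm
    refine ⟨_, hmerge.comp (hΛ₂.comp hsplit), fun ρ => ?_⟩
    rw [copies_succ_submatrix, htensor, hcopies, tensor_copies_submatrix]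

end Tensor

/-! ### Preparing separable states and local filtering -/

section Preparation

variable {A B C D : Type} [Fintype A] [Fintype B] [Fintype C] [Fintype D]

theorem localConj_mul_single_mul_single [DecidableEq A] [DecidableEq B] [DecidableEq C]
    [DecidableEq D] {C' D' : Type*} (K : Matrix C' C ℂ) (L : Matrix D' D ℂ) (a : A) (b : B) (c : C)
    (d : D) (X : Matrix (A × B) (A × B) ℂ) :
    localConj (K * Matrix.single c a (1 : ℂ)) (L * Matrix.single d b (1 : ℂ)) X =
      X (a, b) (a, b) • localConj K L (Matrix.single (c, d) (c, d) 1) := by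
  have h : localConj (Matrix.single c a (1 : ℂ)) (Matrix.single d b (1 : ℂ)) X =
      X (a, b) (a, b) • Matrix.single (c, d) (c, d) 1 := by
    rw [localConj_apply, Matrix.single_kronecker_single, Matrix.conjTranspose_single,
      Matrix.single_mul_mul_single, Matrix.smul_single]
    simp only [mul_one, one_mul, star_one, smul_eq_mul]
  rw [← localConj_localConj, h, map_smul]

theorem sum_conjTranspose_mul_single_mul_self [DecidableEq A] [DecidableEq C] {C' : Type*}
    [Fintype C'] (K : Matrix C' C ℂ) :
    ∑ i : C × A, (K * Matrix.single i.1 i.2 (1 : ℂ))ᴴ * (K * Matrix.single i.1 i.2 (1 : ℂ)) =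
      (Kᴴ * K).trace • (1 : Matrix A A ℂ) := by
  have hterm (i : C × A) :
      (K * Matrix.single i.1 i.2 (1 : ℂ))ᴴ * (K * Matrix.single i.1 i.2 (1 : ℂ)) =
        (Kᴴ * K) i.1 i.1 • Matrix.single i.2 i.2 1 := by
    rw [Matrix.conjTranspose_mul, Matrix.conjTranspose_single, Matrix.mul_assoc,
      ← Matrix.mul_assoc Kᴴ, ← Matrix.mul_assoc, Matrix.single_mul_mul_single,
      Matrix.smul_single]
    simp only [mul_one, one_mul, star_one, smul_eq_mul]
  simp only [hterm, Fintype.sum_prod_type, ← Finset.smul_sum, Matrix.sum_single_one,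
    ← Finset.sum_smul]
  rfl

open scoped MatrixOrder Matrix.Norms.L2Operator in
theorem exists_conjTranspose_mul_self_eq {M : Matrix A A ℂ} (hM : M.PosSemidef) :
    ∃ L : Matrix A A ℂ, Lᴴ * L = M := by
  classical
  exact (CStarAlgebra.nonneg_iff_eq_star_mul_self.mp hM.nonneg).imp fun _ h => h.symm

theorem IsState.exists_eq_mul_conjTranspose {α : Matrix A A ℂ} (hα : IsState α) :
    ∃ K : Matrix A A ℂ, α = K * Kᴴ ∧ (Kᴴ * K).trace = 1 := by
  obtain ⟨L, hL⟩ := exists_conjTranspose_mul_self_eq hα.posSemidef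
  refine ⟨Lᴴ, by rw [Matrix.conjTranspose_conjTranspose, hL], ?_⟩
  rw [Matrix.conjTranspose_conjTranspose, Matrix.trace_mul_comm, hL, hα.trace_eq_one]

theorem isLOCC_trace_smul_kronecker {α : Matrix C C ℂ} {β : Matrix D D ℂ} (hα : IsState α)
    (hβ : IsState β) : IsLOCC fun X : Matrix (A × B) (A × B) ℂ => X.trace • (α ⊗ₖ β) := by
  classical
  obtain ⟨K, rfl, hK⟩ := hα.exists_eq_mul_conjTranspose
  obtain ⟨L, rfl, hL⟩ := hβ.exists_eq_mul_conjTranspose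
  have hcomplete {S T : Type} [Fintype S] [Fintype T] [DecidableEq S] [DecidableEq T]
      {M : Matrix S S ℂ} (hM : (Mᴴ * M).trace = 1) :
      ∑ i : S × T, (M * Matrix.single i.1 i.2 (1 : ℂ))ᴴ * (M * Matrix.single i.1 i.2 (1 : ℂ)) =
        1 := by
    rw [sum_conjTranspose_mul_single_mul_self, hM, one_smul]
  have h := IsLOCC.alice (A := A) (B := B) _ (hcomplete hK) _ fun _ =>
    IsLOCC.bob (A := C) (B := B) _ (hcomplete hL) _ fun _ => IsLOCC.finish
  convert h using 2 with X
  have hsum : ∑ c : C, ∑ d : D, localConj K L (Matrix.single (c, d) (c, d) 1) =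
      (K * Kᴴ) ⊗ₖ (L * Lᴴ) := by
    simp only [← Fintype.sum_prod_type', ← map_sum]
    rw [Matrix.sum_single_one, ← Matrix.one_kronecker_one, localConj_kronecker, Matrix.mul_one,
      Matrix.mul_one]
  have hprod (c : C) (a : A) (d : D) (b : B) :
      localConj (1 : Matrix C C ℂ) (L * Matrix.single d b (1 : ℂ))
        (localConj (K * Matrix.single c a (1 : ℂ)) 1 X) =
          X (a, b) (a, b) • localConj K L (Matrix.single (c, d) (c, d) 1) := by
    rw [localConj_localConj, Matrix.one_mul, Matrix.mul_one, localConj_mul_single_mul_single]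
  simp only [← localConj_apply, Fintype.sum_prod_type, hprod]
  simp only [Finset.sum_comm (s := (Finset.univ : Finset D)) (t := (Finset.univ : Finset B)),
    ← Finset.smul_sum]
  simp only [← Finset.sum_smul, ← Finset.smul_sum, ← hsum, Matrix.trace, Matrix.diag_apply,
    Fintype.sum_prod_type]

theorem isLOCC_trace_smul_of_isSeparable {τ : Matrix (C × D) (C × D) ℂ} (hτ : IsSeparable τ) :
    IsLOCC fun X : Matrix (A × B) (A × B) ℂ => X.trace • τ := by
  let f : Matrix (C × D) (C × D) ℂ →ₗ[ℝ]
      Matrix (A × B) (A × B) ℂ → Matrix (C × D) (C × D) ℂ :=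
    LinearMap.pi fun X => LinearMap.lsmul ℂ _ X.trace |>.restrictScalars ℝ
  refine convexHull_min ?_ (convex_setOf_isLOCC.linear_preimage f) hτ
  rintro _ ⟨α, β, hα, hβ, rfl⟩
  exact isLOCC_trace_smul_kronecker hα hβ

end Preparation

section Filter

theorem posSemidef_one_sub_mul_selection {A E F : Type*} [Finite A] [Fintype E] [Fintype F]
    [DecidableEq A] [DecidableEq F] {K : Matrix E F ℂ}
    (hK : (1 - Kᴴ * K).PosSemidef) {f : F → A} (hf : Function.Injective f) :
    (1 - (K * selection f)ᴴ * (K * selection f)).PosSemidef := by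
  cases nonempty_fintype A
  set S : Matrix F A ℂ := selection f
  have hS : S * Sᴴ = 1 := selection_mul_conjTranspose_selection hf
  have hproj : (1 - Sᴴ * S)ᴴ * (1 - Sᴴ * S) = 1 - Sᴴ * S := by
    have hidem : Sᴴ * S * (Sᴴ * S) = Sᴴ * S := by
      rw [Matrix.mul_assoc, ← Matrix.mul_assoc S, hS, Matrix.one_mul]
    rw [Matrix.conjTranspose_sub, Matrix.conjTranspose_mul, Matrix.conjTranspose_conjTranspose,
      Matrix.conjTranspose_one, Matrix.sub_mul, Matrix.mul_sub, Matrix.mul_sub, hidem,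
      Matrix.one_mul, Matrix.mul_one, Matrix.one_mul, sub_self, sub_zero]
  have hsplit : 1 - (K * S)ᴴ * (K * S) =
      (1 - Sᴴ * S)ᴴ * (1 - Sᴴ * S) + Sᴴ * (1 - Kᴴ * K) * S := by
    rw [hproj, Matrix.mul_sub, Matrix.sub_mul, Matrix.mul_one, Matrix.conjTranspose_mul]
    simp only [Matrix.mul_assoc, sub_add_sub_cancel]
  rw [hsplit]
  exact (Matrix.posSemidef_conjTranspose_mul_self _).add (hK.conjTranspose_mul_mul_same S)

variable {A B C D E F : Type} [Fintype A] [Fintype B] [Fintype E] [Fintype F]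
  [DecidableEq A] [DecidableEq B] {τ : Matrix (C × D) (C × D) ℂ}

theorem trace_localConj_one_right_add {E' : Type} [Fintype E'] {G : Matrix E A ℂ}
    {L : Matrix E' A ℂ} (h : Gᴴ * G + Lᴴ * L = 1) (X : Matrix (A × B) (A × B) ℂ) :
    (localConj G (1 : Matrix B B ℂ) X).trace + (localConj L (1 : Matrix B B ℂ) X).trace =
      X.trace := by
  rw [trace_localConj, trace_localConj, ← Matrix.trace_add, ← Matrix.add_mul,
    ← Matrix.add_kronecker, h, Matrix.conjTranspose_one, Matrix.one_mul,
    Matrix.one_kronecker_one, Matrix.one_mul]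

theorem trace_localConj_one_left_add {F' : Type} [Fintype F'] {G : Matrix F B ℂ}
    {L : Matrix F' B ℂ} (h : Gᴴ * G + Lᴴ * L = 1) (X : Matrix (A × B) (A × B) ℂ) :
    (localConj (1 : Matrix A A ℂ) G X).trace + (localConj (1 : Matrix A A ℂ) L X).trace =
      X.trace := by
  rw [trace_localConj, trace_localConj, ← Matrix.trace_add, ← Matrix.add_mul,
    ← Matrix.kronecker_add, h, Matrix.conjTranspose_one, Matrix.one_mul,
    Matrix.one_kronecker_one, Matrix.one_mul]

theorem isLOCC_filter_alice {K : Matrix E A ℂ} (hK : (1 - Kᴴ * K).PosSemidef)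
    {Λ : Matrix (E × B) (E × B) ℂ → Matrix (C × D) (C × D) ℂ} (hΛ : IsLOCC Λ)
    (hτ : IsLOCC fun X : Matrix (A × B) (A × B) ℂ => X.trace • τ) :
    IsLOCC fun X : Matrix (A × B) (A × B) ℂ =>
      Λ (localConj K 1 X) + (X.trace - (localConj K (1 : Matrix B B ℂ) X).trace) • τ := by
  obtain ⟨L, hL⟩ := exists_conjTranspose_mul_self_eq hK
  have hcomplete : Kᴴ * K + Lᴴ * L = 1 := by rw [hL, add_sub_cancel]
  let _ (i : Bool) : Fintype (cond i E A) := by cases i <;> assumption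
  have h := IsLOCC.alice (B := B) (ι := Bool) (E := fun i => cond i E A)
    (fun | true => K | false => L) (by rw [Fintype.sum_bool]; exact hcomplete)
    (fun | true => Λ | false => fun X => X.trace • τ) (fun | true => hΛ | false => hτ)
  simp only [Fintype.sum_bool] at h
  simp only [sub_eq_of_eq_add' (trace_localConj_one_right_add hcomplete _).symm]
  exact h

theorem isLOCC_filter_bob {K : Matrix F B ℂ} (hK : (1 - Kᴴ * K).PosSemidef)
    {Λ : Matrix (A × F) (A × F) ℂ → Matrix (C × D) (C × D) ℂ} (hΛ : IsLOCC Λ)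
    (hτ : IsLOCC fun X : Matrix (A × B) (A × B) ℂ => X.trace • τ) :
    IsLOCC fun X : Matrix (A × B) (A × B) ℂ =>
      Λ (localConj 1 K X) + (X.trace - (localConj (1 : Matrix A A ℂ) K X).trace) • τ := by
  obtain ⟨L, hL⟩ := exists_conjTranspose_mul_self_eq hK
  have hcomplete : Kᴴ * K + Lᴴ * L = 1 := by rw [hL, add_sub_cancel]
  let _ (i : Bool) : Fintype (cond i F B) := by cases i <;> assumption
  have h := IsLOCC.bob (A := A) (ι := Bool) (E := fun i => cond i F B)
    (fun | true => K | false => L) (by rw [Fintype.sum_bool]; exact hcomplete)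
    (fun | true => Λ | false => fun X => X.trace • τ) (fun | true => hΛ | false => hτ)
  simp only [Fintype.sum_bool] at h
  simp only [sub_eq_of_eq_add' (trace_localConj_one_left_add hcomplete _).symm]
  exact h

theorem isLOCC_filter {τ : Matrix (E × F) (E × F) ℂ} (hτ : IsSeparable τ) {K : Matrix E A ℂ}
    (hK : (1 - Kᴴ * K).PosSemidef) {L : Matrix F B ℂ} (hL : (1 - Lᴴ * L).PosSemidef) :
    IsLOCC fun X : Matrix (A × B) (A × B) ℂ =>
      localConj K L X + (X.trace - (localConj K L X).trace) • τ := by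
  classical
  have h := isLOCC_filter_alice (B := B) hK
    (isLOCC_filter_bob hL IsLOCC.finish (isLOCC_trace_smul_of_isSeparable hτ))
    (isLOCC_trace_smul_of_isSeparable hτ)
  convert h using 2 with X
  rw [localConj_localConj, Matrix.one_mul, Matrix.mul_one]
  module

end Filter

/-! ### Phase-damped Bell pairs from a single coherence -/

/-- The two-qubit state with equal populations of `|00⟩` and `|11⟩` and with coherence `t / 2`
between them: a Bell pair whose off-diagonal entries are damped by the factor `t`. -/
def dephased (t : ℝ) : Matrix (Fin 2 × Fin 2) (Fin 2 × Fin 2) ℂ :=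
  Matrix.of fun x y => if x.1 = x.2 ∧ y.1 = y.2 then (if x = y then 1 / 2 else (t : ℂ) / 2) else 0

theorem trace_dephased (t : ℝ) : (dephased t).trace = 1 := by
  simp [Matrix.trace, dephased, Fintype.sum_prod_type]

theorem isDiag_dephased_zero : (dephased 0).IsDiag := fun x y hxy => by
  simp [dephased, hxy]

theorem isState_dephased_zero : IsState (dephased 0) where
  posSemidef := by
    rw [← isDiag_dephased_zero.diagonal_diag, Matrix.posSemidef_diagonal_iff]
    intro x
    rw [Matrix.diag_apply, dephased, Matrix.of_apply, if_pos rfl]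
    split_ifs
    · exact one_half_pos.le
    · exact le_rfl
  trace_eq_one := trace_dephased 0

theorem smul_dephased_add_smul_dephased_zero (r t : ℝ) :
    (r : ℂ) • dephased t + (1 - r : ℂ) • dephased 0 = dephased (r * t) := by
  ext x y
  simp only [dephased, Matrix.add_apply, Matrix.smul_apply, Matrix.of_apply, smul_eq_mul]
  split_ifs <;> push_cast <;> ring

theorem localConj_diagonal {A B : Type*} [Fintype A] [Fintype B] [DecidableEq A] [DecidableEq B]
    (f : A → ℂ) (g : B → ℂ) (X : Matrix (A × B) (A × B) ℂ) (x y : A × B) :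
    localConj (Matrix.diagonal f) (Matrix.diagonal g) X x y =
      f x.1 * g x.2 * X x y * star (f y.1 * g y.2) := by
  rw [localConj_apply, Matrix.diagonal_kronecker_diagonal, Matrix.diagonal_conjTranspose,
    Matrix.mul_diagonal, Matrix.diagonal_mul, Pi.star_apply]

theorem posSemidef_one_sub_diagonal {A : Type*} [Fintype A] [DecidableEq A] {f : A → ℂ}
    (hf : ∀ a, ‖f a‖ ≤ 1) :
    (1 - (Matrix.diagonal f)ᴴ * Matrix.diagonal f).PosSemidef := by
  rw [Matrix.diagonal_conjTranspose, Matrix.diagonal_mul_diagonal, ← Matrix.diagonal_one,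
    Matrix.diagonal_sub, Matrix.posSemidef_diagonal_iff]
  intro a
  rw [Pi.star_apply, RCLike.star_def, Complex.conj_mul', sub_nonneg]
  exact_mod_cast pow_le_one₀ (norm_nonneg _) (hf a)

section TwoQubit

variable {σ : Matrix (Fin 2 × Fin 2) (Fin 2 × Fin 2) ℂ}

theorem localConj_diagonal_eq_smul_dephased (hσ : σ.PosSemidef) (h01 : σ (0, 1) (0, 1) = 0)
    (h10 : σ (1, 0) (1, 0) = 0) {f : Fin 2 → ℂ} {r t : ℝ}
    (h00 : f 0 * σ (0, 0) (0, 0) * star (f 0) = r / 2)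
    (h11 : f 1 * σ (1, 1) (1, 1) * star (f 1) = r / 2)
    (hcoh : f 0 * σ (0, 0) (1, 1) * star (f 1) = r * t / 2) :
    localConj (Matrix.diagonal f) 1 σ = (r : ℂ) • dephased t := by
  have hcoh' : f 1 * σ (1, 1) (0, 0) * star (f 0) = r * t / 2 := by
    have h := congrArg star hcoh
    rw [star_mul', star_mul', star_star, hσ.isHermitian.apply, star_div₀, star_mul'] at h
    simp only [RCLike.star_def, Complex.conj_ofReal, map_ofNat] at h ⊢
    linear_combination h
  have hpop {x : Fin 2 × Fin 2} (hx : x.1 ≠ x.2) : σ x x = 0 := by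
    obtain ⟨i, j⟩ := x
    fin_cases i <;> fin_cases j <;> first | exact absurd rfl hx | assumption
  ext ⟨i, i'⟩ ⟨j, j'⟩
  rw [← Matrix.diagonal_one, localConj_diagonal, Matrix.smul_apply, dephased, Matrix.of_apply]
  by_cases hx : i = i'
  · by_cases hy : j = j'
    · subst hx hy
      fin_cases i <;> fin_cases j <;> simp_all <;> ring
    · simp [apply_eq_zero_of_posSemidef_of_diag_right hσ (hpop (x := (j, j')) hy), hy]
  · simp [apply_eq_zero_of_posSemidef_of_diag_left hσ (hpop (x := (i, i')) hx), hx]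

theorem exists_localConj_diagonal_eq_smul_dephased (hσ : σ.PosSemidef)
    (h01 : σ (0, 1) (0, 1) = 0) (h10 : σ (1, 0) (1, 0) = 0) (hc : σ (0, 0) (1, 1) ≠ 0)
    (htr : (σ (0, 0) (0, 0)).re + (σ (1, 1) (1, 1)).re ≤ 1) :
    ∃ f : Fin 2 → ℂ, (∀ i, ‖f i‖ ≤ 1) ∧ ∃ r ∈ Set.Ioc (0 : ℝ) 1, ∃ t ∈ Set.Ioc (0 : ℝ) 1,
      localConj (Matrix.diagonal f) 1 σ = (r : ℂ) • dephased t := by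
  set p := (σ (0, 0) (0, 0)).re
  set q := (σ (1, 1) (1, 1)).re
  set c := σ (0, 0) (1, 1)
  have hp : σ (0, 0) (0, 0) = p := Complex.eq_re_of_ofReal_le hσ.diag_nonneg
  have hq : σ (1, 1) (1, 1) = q := Complex.eq_re_of_ofReal_le hσ.diag_nonneg
  have hp0 : 0 ≤ p := (Complex.nonneg_iff.mp hσ.diag_nonneg).1
  have hq0 : 0 ≤ q := (Complex.nonneg_iff.mp hσ.diag_nonneg).1
  have hc0 : 0 < ‖c‖ := norm_pos_iff.mpr hc
  have hcpq : ‖c‖ ^ 2 ≤ p * q := norm_sq_apply_le_of_posSemidef hσ _ _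
  have hpq : 0 < p * q := (pow_pos hc0 2).trans_le hcpq
  have hsqrt : 0 < √(p * q) := Real.sqrt_pos.mpr hpq
  obtain ⟨u, hu, huc⟩ := Complex.exists_norm_eq_mul_self c
  have hsq {s : ℝ} (hs : 0 ≤ s) : (√s : ℂ) * √s = s := by
    rw [← Complex.ofReal_mul, Real.mul_self_sqrt hs]
  refine ⟨![√q * u, √p], ?_, 2 * (p * q), ⟨by positivity, by nlinarith [sq_nonneg (p - q)]⟩,
    ‖c‖ / √(p * q), ⟨by positivity, (div_le_one hsqrt).mpr (Real.le_sqrt_of_sq_le hcpq)⟩,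
    localConj_diagonal_eq_smul_dephased hσ h01 h10 ?_ ?_ ?_⟩
  · have hle {s : ℝ} (hs : s ≤ 1) : ‖(√s : ℂ)‖ ≤ 1 := by
      rw [Complex.norm_real, Real.norm_of_nonneg (Real.sqrt_nonneg s)]
      exact Real.sqrt_le_one.mpr hs
    rw [Fin.forall_fin_two]
    refine ⟨?_, hle (by linarith)⟩
    rw [Matrix.cons_val_zero, norm_mul, hu, mul_one]
    exact hle (by linarith)
  · have huu : u * star u = 1 := by
      rw [RCLike.star_def, Complex.mul_conj', hu, Complex.ofReal_one, one_pow]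
    simp only [Matrix.cons_val_zero, star_mul', RCLike.star_def, Complex.conj_ofReal, hp] at huu ⊢
    push_cast
    linear_combination (√q : ℂ) * √q * p * huu + p * hsq hq0
  · rw [Matrix.cons_val_one, Matrix.cons_val_fin_one, RCLike.star_def, Complex.conj_ofReal, hq]
    push_cast
    linear_combination q * hsq hp0
  · have hdamp : 2 * (p * q) * (‖c‖ / √(p * q)) / 2 = √q * ‖c‖ * √p := by
      have hdiv : p * q / √(p * q) = √p * √q := by rw [Real.div_sqrt, Real.sqrt_mul hp0]
      linear_combination ‖c‖ * hdiv
    rw [Matrix.cons_val_zero, Matrix.cons_val_one, Matrix.cons_val_fin_one, RCLike.star_def,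
      Complex.conj_ofReal, mul_assoc (√q : ℂ), ← huc]
    exact_mod_cast hdamp.symm

end TwoQubit

theorem exists_isLOCC_dephased {A B : Type} [Fintype A] [Fintype B]
    {σ : Matrix (A × B) (A × B) ℂ} (hσ : IsState σ) {a a' : A} {b b' : B}
    (hc : σ (a, b) (a', b') ≠ 0) (h1 : σ (a, b') (a, b') = 0) (h2 : σ (a', b) (a', b) = 0) :
    ∃ t ∈ Set.Ioc (0 : ℝ) 1,
      ∃ Λ : Matrix (A × B) (A × B) ℂ → Matrix (Fin 2 × Fin 2) (Fin 2 × Fin 2) ℂ,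
        IsLOCC Λ ∧ Λ σ = dephased t := by
  classical
  have ha : a ≠ a' := by
    rintro rfl
    exact hc (apply_eq_zero_of_posSemidef_of_diag_right hσ.posSemidef h1 _)
  have hb : b ≠ b' := by
    rintro rfl
    exact hc (apply_eq_zero_of_posSemidef_of_diag_left hσ.posSemidef h1 _)
  have hpop : (σ (a, b) (a, b)).re + (σ (a', b') (a', b')).re ≤ 1 := by
    have htr : ∑ x, (σ x x).re = 1 := by
      simpa [Matrix.trace] using congrArg Complex.re hσ.trace_eq_one
    rw [← htr]
    exact Finset.add_le_sum (f := fun x => (σ x x).re)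
      (fun x _ => (Complex.nonneg_iff.mp hσ.posSemidef.diag_nonneg).1)
      (Finset.mem_univ _) (Finset.mem_univ _) fun h => ha (Prod.mk.inj h).1
  set e : Fin 2 × Fin 2 → A × B := Prod.map ![a, a'] ![b, b']
  obtain ⟨f, hf, r, hr, t, ht, hfilter⟩ := exists_localConj_diagonal_eq_smul_dephased
    (hσ.posSemidef.submatrix e) h1 h2 hc hpop
  have hone : (1 - (1 : Matrix (Fin 2) (Fin 2) ℂ)ᴴ * 1).PosSemidef := by
    rw [Matrix.conjTranspose_one, Matrix.one_mul, sub_self]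
    exact Matrix.PosSemidef.zero
  have hK := posSemidef_one_sub_mul_selection (posSemidef_one_sub_diagonal hf)
    (injective_pair_iff_ne.mpr ha)
  have hL := posSemidef_one_sub_mul_selection hone (injective_pair_iff_ne.mpr hb)
  have hsep := isSeparable_of_isDiag isState_dephased_zero isDiag_dephased_zero
  refine ⟨r * t, ⟨mul_pos hr.1 ht.1, mul_le_one₀ hr.2 ht.1.le ht.2⟩, _,
    isLOCC_filter hsep hK hL, ?_⟩
  rw [← localConj_localConj, localConj_selection, hfilter, hσ.trace_eq_one, Matrix.trace_smul,
    trace_dephased, smul_eq_mul, mul_one, smul_dephased_add_smul_dephased_zero]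

/-! ### Hashing with random linear codes -/

section ShiftMixture

variable {V : Type} [Fintype V] [AddCommGroup V] [DecidableEq V]

/-- The state on `V ⊗ V` that is maximally entangled up to a shift of the second factor by a random
`-e : V`, distributed according to `P`. -/
def shiftMixture (P : V → ℝ) : Matrix (V × V) (V × V) ℂ :=
  Matrix.of fun x y =>
    if x.1 - x.2 = y.1 - y.2 then ((P (x.1 - x.2) / Fintype.card V : ℝ) : ℂ) else 0

theorem copies_shiftMixture (P : V → ℝ) (n : ℕ) :
    copies (shiftMixture P) n = shiftMixture fun e : Fin n → V => ∏ i, P (e i) := by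
  ext x y
  simp only [copies, shiftMixture, Matrix.of_apply]
  by_cases h : ∀ i, x.1 i - x.2 i = y.1 i - y.2 i
  · rw [if_pos (show x.1 - x.2 = y.1 - y.2 from funext h),
      Finset.prod_congr rfl fun i _ => if_pos (h i), ← Complex.ofReal_prod,
      Finset.prod_div_distrib, Finset.prod_const, Finset.card_univ, Fintype.card_pi_const,
      Fintype.card_fin]
    push_cast
    rfl
  · obtain ⟨i, hi⟩ := not_forall.mp h
    rw [if_neg fun hxy => hi (congrFun hxy i),
      Finset.prod_eq_zero (Finset.mem_univ i) (if_neg hi)]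

end ShiftMixture

section Collision

variable {V : Type*} [Fintype V] [AddCommGroup V]

open Classical in
/-- The weight `∑ √(P e) √(P e')` of the pairs of distinct errors `e`, `e'` in a common coset of
`C`: the Bhattacharyya bound on the probability of decoding an error wrongly from its coset. -/
def collision (P : V → ℝ) (C : AddSubgroup V) : ℝ :=
  ∑ e, ∑ e', if e ≠ e' ∧ e - e' ∈ C then √(P e) * √(P e') else 0

theorem apply_le_sum_sqrt_mul_sqrt {P : V → ℝ} (hP : ∀ e, 0 ≤ P e) {C : AddSubgroup V} {e e' : V}
    (hne : e ≠ e') (hC : e - e' ∈ C) (hle : P e ≤ P e') [DecidableEq V] [DecidablePred (· ∈ C)] :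
    P e ≤ ∑ d, if e ≠ d ∧ e - d ∈ C then √(P e) * √(P d) else 0 :=
  calc P e = √(P e) * √(P e) := (Real.mul_self_sqrt (hP e)).symm
    _ ≤ √(P e) * √(P e') := by gcongr
    _ = if e ≠ e' ∧ e - e' ∈ C then √(P e) * √(P e') else 0 := (if_pos ⟨hne, hC⟩).symm
    _ ≤ _ := Finset.single_le_sum
      (f := fun d => if e ≠ d ∧ e - d ∈ C then √(P e) * √(P d) else 0)
      (fun _ _ => by positivity) (Finset.mem_univ e')

theorem exists_section_sub_collision_le {P : V → ℝ} (hP : ∀ e, 0 ≤ P e) (C : AddSubgroup V)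
    [Fintype (V ⧸ C)] :
    ∃ s : V ⧸ C → V, (∀ q, (s q : V ⧸ C) = q) ∧ ∑ e, P e - collision P C ≤ ∑ q, P (s q) := by
  classical
  have hlikeliest (q : V ⧸ C) :
      ∃ v : V, (v : V ⧸ C) = q ∧ ∀ e : V, (e : V ⧸ C) = q → P e ≤ P v := by
    obtain ⟨v₀, hv₀⟩ := QuotientAddGroup.mk_surjective q
    obtain ⟨v, hv, hmax⟩ := Finset.exists_max_image
      (Finset.univ.filter fun v : V => (v : V ⧸ C) = q) P ⟨v₀, by simpa using hv₀⟩
    exact ⟨v, by simpa using hv, fun e he => hmax e (by simpa using he)⟩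
  choose s hs hmax using hlikeliest
  have hsinj : Function.Injective s := Function.LeftInverse.injective hs
  refine ⟨s, hs, sub_le_iff_le_add.mpr ?_⟩
  rw [← Finset.sum_image (s := Finset.univ) (g := s) (f := P) hsinj.injOn,
    ← Finset.sum_add_sum_compl (Finset.univ.image s) P, collision]
  refine add_le_add_right (le_trans (Finset.sum_le_sum fun e he => ?_)
    (Finset.sum_le_univ_sum_of_nonneg fun e => Finset.sum_nonneg fun _ _ => by positivity)) _
  refine apply_le_sum_sqrt_mul_sqrt hP (e' := s (e : V ⧸ C)) ?_ ?_ (hmax _ e rfl)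
  · intro h
    exact Finset.mem_compl.mp he (Finset.mem_image.mpr ⟨_, Finset.mem_univ _, h.symm⟩)
  · rw [← QuotientAddGroup.eq_iff_sub_mem, hs]

end Collision

section RandomLinearMap

variable (𝔽 : Type*) {V : Type*} (G : Type*) [Field 𝔽] [AddCommGroup V] [Module 𝔽 V]
  [AddCommGroup G] [Module 𝔽 G]

theorem card_mul_card_linearMap_apply_eq_zero {x : V} (hx : x ≠ 0) :
    Nat.card G * Nat.card {f : V →ₗ[𝔽] G // f x = 0} = Nat.card (V →ₗ[𝔽] G) := by
  have hsurj : Function.Surjective (LinearMap.applyₗ (R := 𝔽) (M₂ := G) x) := fun g => by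
    obtain ⟨φ, hφ⟩ := Module.Projective.exists_dual_ne_zero 𝔽 hx
    exact ⟨φ.smulRight ((φ x)⁻¹ • g), by simp [hφ]⟩
  have hker := (LinearMap.applyₗ (R := 𝔽) (M₂ := G) x).toAddMonoidHom.ker.index_mul_card
  rw [AddSubgroup.index_ker, AddMonoidHom.range_eq_top.mpr hsurj, AddSubgroup.card_top] at hker
  exact hker

theorem exists_linearMap_card_mul_collision_ker_le [Fintype V] [Finite G] (P : V → ℝ) :
    ∃ f : V →ₗ[𝔽] G,
      Nat.card G * collision P (LinearMap.ker f).toAddSubgroup ≤ (∑ e, √(P e)) ^ 2 := by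
  classical
  have := Finite.of_injective _ (DFunLike.coe_injective (F := V →ₗ[𝔽] G))
  have := Fintype.ofFinite (V →ₗ[𝔽] G)
  have hpair (e e' : V) : Nat.card G * ∑ f : V →ₗ[𝔽] G,
      (if e ≠ e' ∧ e - e' ∈ (LinearMap.ker f).toAddSubgroup then √(P e) * √(P e') else 0) ≤
        Nat.card (V →ₗ[𝔽] G) * (√(P e) * √(P e')) := by
    by_cases h : e = e'
    · simp only [h, ne_eq, not_true_eq_false, false_and, if_false, Finset.sum_const_zero, mul_zero]
      positivity
    · have hcard := card_mul_card_linearMap_apply_eq_zero 𝔽 G (sub_ne_zero.mpr h)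
      rw [Nat.card_eq_fintype_card (α := {f : V →ₗ[𝔽] G // f (e - e') = 0}),
        Fintype.card_subtype] at hcard
      simp only [ne_eq, h, not_false_eq_true, true_and, Submodule.mem_toAddSubgroup,
        LinearMap.mem_ker]
      rw [← Finset.sum_filter, Finset.sum_const, nsmul_eq_mul, ← mul_assoc, ← hcard, Nat.cast_mul]
  have hmean : ∑ f : V →ₗ[𝔽] G, Nat.card G * collision P (LinearMap.ker f).toAddSubgroup ≤
      ∑ _f : V →ₗ[𝔽] G, (∑ e, √(P e)) ^ 2 := by
    rw [Finset.sum_const, Finset.card_univ, ← Nat.card_eq_fintype_card, nsmul_eq_mul, sq,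
      Finset.sum_mul_sum, Finset.mul_sum, ← Finset.mul_sum]
    simp only [collision]
    rw [Finset.sum_comm, Finset.mul_sum]
    refine Finset.sum_le_sum fun e _ => ?_
    rw [Finset.sum_comm, Finset.mul_sum, Finset.mul_sum]
    exact Finset.sum_le_sum fun e' _ => hpair e e'
  obtain ⟨f, -, hf⟩ := Finset.exists_le_of_sum_le Finset.univ_nonempty hmean
  exact ⟨f, hf⟩

end RandomLinearMap

theorem maxEntangledFidelity_eq {K : ℕ} (σ : Matrix (Fin K × Fin K) (Fin K × Fin K) ℂ) :
    maxEntangledFidelity σ = (K : ℝ)⁻¹ * ∑ i, ∑ j, (σ (i, i) (j, j)).re := by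
  have hK : (√(K : ℝ))⁻¹ * (√(K : ℝ))⁻¹ = (K : ℝ)⁻¹ := by
    rw [← mul_inv, Real.mul_self_sqrt (Nat.cast_nonneg K)]
  have hstar (p : Prop) [Decidable p] (z : ℝ) :
      star (if p then (z : ℂ) else 0) = if p then (z : ℂ) else 0 := by
    split_ifs <;> simp
  simp only [maxEntangledFidelity, dotProduct, Matrix.mulVec, maxEntangled, Pi.star_apply,
    Fintype.sum_prod_type, hstar, mul_ite, ite_mul, mul_zero, zero_mul, Finset.sum_ite_eq,
    Finset.mem_univ, if_true, ← Finset.sum_mul]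
  simp only [Complex.re_sum, Complex.re_ofReal_mul, Complex.re_mul_ofReal, Finset.sum_mul,
    Finset.mul_sum, ← hK]
  exact Finset.sum_congr rfl fun i _ => Finset.sum_congr rfl fun j _ => by ring

section Hashing

variable {V : Type} [AddCommGroup V] [DecidableEq V] {C : AddSubgroup V}

/-- The measurement operator that projects onto the coset `C + v` and identifies it with the index
set `E` of `C`. -/
def cosetProjection {E : Type*} (ε : E ≃ C) (v : V) : Matrix E V ℂ :=
  selection fun j => (ε j : V) + v

theorem sum_conjTranspose_cosetProjection_mul [Finite V] {E ι : Type*} [Fintype E] [Fintype ι]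
    (ε : E ≃ C) {r : ι → V} (hr : Function.Bijective fun i => (r i : V ⧸ C)) :
    ∑ i, (cosetProjection ε (r i))ᴴ * cosetProjection ε (r i) = 1 := by
  cases nonempty_fintype V
  have hbij : Function.Bijective fun y : ι × E => (ε y.2 : V) + r y.1 := by
    constructor
    · rintro ⟨i, j⟩ ⟨i', j'⟩ h
      have hi : i = i' := hr.injective <| by
        simpa only [QuotientAddGroup.mk_add, (QuotientAddGroup.eq_zero_iff _).mpr (ε _).2,
          zero_add] using congrArg (QuotientAddGroup.mk : V → V ⧸ C) h
      subst hi
      exact congrArg _ (ε.injective (Subtype.ext (add_right_cancel h)))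
    · intro x
      obtain ⟨i, hi⟩ := hr.surjective x
      exact ⟨(i, ε.symm ⟨x - r i, QuotientAddGroup.eq_iff_sub_mem.mp hi.symm⟩), by simp⟩
  simp only [cosetProjection, conjTranspose_selection_mul_selection]
  rw [← Fintype.sum_prod_type'
    (f := fun (i : ι) (j : E) => Matrix.single ((ε j : V) + r i) ((ε j : V) + r i) (1 : ℂ)),
    hbij.sum_comp fun x => Matrix.single x x (1 : ℂ), Matrix.sum_single_one]

variable [Fintype V]

theorem localConj_cosetProjection_shiftMixture {E : Type} (ε : E ≃ C) (P : V → ℝ) (u v : V)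
    (i j : E) :
    localConj (cosetProjection ε u) (cosetProjection ε (u - v)) (shiftMixture P) (i, i) (j, j) =
      ((P v / Fintype.card V : ℝ) : ℂ) := by
  rw [cosetProjection, cosetProjection, localConj_selection]
  simp [shiftMixture]

theorem exists_isLOCC_maxEntangledFidelity_shiftMixture [Fintype (V ⧸ C)] (P : V → ℝ)
    {s : V ⧸ C → V} (hs : ∀ q, (s q : V ⧸ C) = q) :
    ∃ Λ : Matrix (V × V) (V × V) ℂ →
        Matrix (Fin (Nat.card C) × Fin (Nat.card C)) (Fin (Nat.card C) × Fin (Nat.card C)) ℂ,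
      IsLOCC Λ ∧ maxEntangledFidelity (Λ (shiftMixture P)) = ∑ q, P (s q) := by
  set ε : Fin (Nat.card C) ≃ C := (Finite.equivFin C).symm
  have halice : Function.Bijective fun q => (s q : V ⧸ C) := by
    simp only [hs]
    exact Function.bijective_id
  have hbob (q : V ⧸ C) : Function.Bijective fun q' => ((s q - s q' : V) : V ⧸ C) := by
    simp only [QuotientAddGroup.mk_sub, hs]
    exact (Equiv.subLeft q).bijective
  have hcard : (Fintype.card V : ℝ) = Fintype.card (V ⧸ C) * Nat.card C := by
    rw [← Nat.card_eq_fintype_card, ← Nat.card_eq_fintype_card]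
    exact_mod_cast C.card_eq_card_quotient_mul_card_addSubgroup
  have hC : (Nat.card C : ℝ) ≠ 0 := Nat.cast_ne_zero.mpr Nat.card_pos.ne'
  have hquot : (Fintype.card (V ⧸ C) : ℝ) ≠ 0 := Nat.cast_ne_zero.mpr Fintype.card_ne_zero
  refine ⟨_, IsLOCC.alice _ (sum_conjTranspose_cosetProjection_mul ε halice) _ fun q =>
    IsLOCC.bob _ (sum_conjTranspose_cosetProjection_mul ε (hbob q)) (fun _ X => X)
      fun _ => IsLOCC.finish, ?_⟩
  simp only [← localConj_apply, localConj_localConj, Matrix.one_mul, Matrix.mul_one]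
  simp only [maxEntangledFidelity_eq, Matrix.sum_apply, localConj_cosetProjection_shiftMixture,
    ← Complex.ofReal_sum, Complex.ofReal_re]
  simp only [Finset.sum_const, Finset.card_univ, Fintype.card_fin, nsmul_eq_mul, ← Finset.sum_div,
    hcard]
  field_simp

theorem exists_isLOCC_le_maxEntangledFidelity_shiftMixture (𝔽 : Type*) (G : Type*) [Field 𝔽]
    [Module 𝔽 V] [AddCommGroup G] [Module 𝔽 G] [Finite G] {P : V → ℝ} (hP : ∀ e, 0 ≤ P e) :
    ∃ K : ℕ, Nat.card V ≤ Nat.card G * K ∧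
      ∃ Λ : Matrix (V × V) (V × V) ℂ → Matrix (Fin K × Fin K) (Fin K × Fin K) ℂ,
        IsLOCC Λ ∧ ∑ e, P e - (∑ e, √(P e)) ^ 2 / Nat.card G ≤
          maxEntangledFidelity (Λ (shiftMixture P)) := by
  obtain ⟨f, hf⟩ := exists_linearMap_card_mul_collision_ker_le 𝔽 G P
  set C := (LinearMap.ker f).toAddSubgroup
  have := Fintype.ofFinite (V ⧸ C)
  obtain ⟨s, hs, hdecode⟩ := exists_section_sub_collision_le hP C
  obtain ⟨Λ, hΛ, hfid⟩ := exists_isLOCC_maxEntangledFidelity_shiftMixture P hs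
  have hG : (0 : ℝ) < Nat.card G := Nat.cast_pos.mpr Nat.card_pos
  refine ⟨Nat.card C, ?_, Λ, hΛ, ?_⟩
  · have hindex := f.toAddMonoidHom.ker.index_mul_card
    rw [AddSubgroup.index_ker] at hindex
    rw [← hindex]
    exact Nat.mul_le_mul_right _ (Nat.card_le_card_of_injective _ Subtype.val_injective)
  · rw [hfid]
    exact (sub_le_sub_left ((le_div_iff₀' hG).mpr hf) _).trans hdecode

end Hashing

/-! ### Distillation of phase-damped Bell pairs -/

theorem sum_univ_zmod_two {M : Type*} [AddCommMonoid M] (f : ZMod 2 → M) :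
    ∑ r, f r = f 0 + f 1 := Fin.sum_univ_two f

section FlipProb

/-- The distribution of a phase error, of bias `t`, in the Hadamard-rotated pair `dephased t`. -/
def flipProb (t : ℝ) (e : ZMod 2) : ℝ := if e = 0 then (1 + t) / 2 else (1 - t) / 2

variable {t : ℝ}

theorem flipProb_nonneg (h0 : 0 ≤ t) (h1 : t ≤ 1) (e : ZMod 2) : 0 ≤ flipProb t e := by
  rw [flipProb]
  split_ifs <;> linarith

theorem sum_flipProb (t : ℝ) : ∑ e, flipProb t e = 1 := by
  simp only [sum_univ_zmod_two, flipProb, if_true, one_ne_zero, if_false]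
  ring

theorem sum_sqrt_flipProb_sq (h0 : 0 ≤ t) (h1 : t ≤ 1) :
    (∑ e, √(flipProb t e)) ^ 2 = 1 + √(1 - t ^ 2) := by
  have hgeom : √(flipProb t 0 * flipProb t 1) = √(1 - t ^ 2) / 2 := by
    simp only [flipProb, if_true, one_ne_zero, if_false]
    rw [show (1 + t) / 2 * ((1 - t) / 2) = (1 - t ^ 2) / 2 ^ 2 by ring,
      Real.sqrt_div' _ (by norm_num), Real.sqrt_sq (by norm_num)]
  have hsum : flipProb t 0 + flipProb t 1 = 1 := by rw [← sum_univ_zmod_two, sum_flipProb]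
  calc (∑ e, √(flipProb t e)) ^ 2 = (√(flipProb t 0) + √(flipProb t 1)) ^ 2 :=
        by rw [sum_univ_zmod_two]
    _ = flipProb t 0 + flipProb t 1 + 2 * √(flipProb t 0 * flipProb t 1) := by
        rw [add_sq, Real.sq_sqrt (flipProb_nonneg h0 h1 0), Real.sq_sqrt (flipProb_nonneg h0 h1 1),
          Real.sqrt_mul (flipProb_nonneg h0 h1 0)]
        ring
    _ = 1 + √(1 - t ^ 2) := by rw [hsum, hgeom]; ring

end FlipProb

/-- The Hadamard matrix, with output basis labelled by `ZMod 2` so that phase errors become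
shifts. -/
def hadamard : Matrix (ZMod 2) (Fin 2) ℂ :=
  Matrix.of fun r i => ((√2 : ℝ) : ℂ)⁻¹ * if r = 1 ∧ i = 1 then -1 else 1

theorem inv_sqrt_two_mul_self : ((√2 : ℝ) : ℂ)⁻¹ * ((√2 : ℝ) : ℂ)⁻¹ = 1 / 2 := by
  rw [← mul_inv, ← Complex.ofReal_mul, Real.mul_self_sqrt zero_le_two, Complex.ofReal_ofNat,
    one_div]

theorem conjTranspose_hadamard_mul_hadamard :
    hadamardᴴ * hadamard = (1 : Matrix (Fin 2) (Fin 2) ℂ) := by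
  ext i j
  fin_cases i <;> fin_cases j <;> simp [hadamard, Matrix.mul_apply, sum_univ_zmod_two] <;>
    linear_combination 2 * inv_sqrt_two_mul_self

theorem localConj_hadamard_dephased (t : ℝ) :
    localConj hadamard hadamard (dephased t) = shiftMixture (flipProb t) := by
  have hbit : ∀ r : ZMod 2, r = 0 ∨ r = 1 := by decide
  have hconj : (starRingEnd ℂ) ((√2 : ℝ) : ℂ)⁻¹ = ((√2 : ℝ) : ℂ)⁻¹ := by
    rw [map_inv₀, Complex.conj_ofReal]
  have hsq := inv_sqrt_two_mul_self
  rw [localConj_apply]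
  ext ⟨x, x'⟩ ⟨y, y'⟩
  set s := ((√2 : ℝ) : ℂ)⁻¹ with hs
  have hquartic : s ^ 4 = 1 / 4 := by linear_combination (s * s + 1 / 2) * hsq
  rcases hbit x with rfl | rfl <;> rcases hbit x' with rfl | rfl <;>
    rcases hbit y with rfl | rfl <;> rcases hbit y' with rfl | rfl <;>
    simp [hadamard, dephased, shiftMixture, flipProb, Matrix.mul_apply, Fintype.sum_prod_type,
      Fin.sum_univ_two, ← hs, hconj] <;> ring_nf <;> (try rw [hquartic]) <;> ring_nf

theorem exists_isLOCC_le_maxEntangledFidelity_copies {t : ℝ} (h0 : 0 ≤ t) (h1 : t ≤ 1) {n k : ℕ}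
    (hk : k ≤ n) :
    ∃ K : ℕ, 2 ^ k ≤ K ∧
      ∃ Λ : Matrix ((Fin n → ZMod 2) × (Fin n → ZMod 2)) ((Fin n → ZMod 2) × (Fin n → ZMod 2)) ℂ →
          Matrix (Fin K × Fin K) (Fin K × Fin K) ℂ,
        IsLOCC Λ ∧ 1 - 2 ^ k * ((1 + √(1 - t ^ 2)) / 2) ^ n ≤
          maxEntangledFidelity (Λ (copies (shiftMixture (flipProb t)) n)) := by
  have hnonneg (e : Fin n → ZMod 2) : 0 ≤ ∏ i, flipProb t (e i) :=
    Finset.prod_nonneg fun _ _ => flipProb_nonneg h0 h1 _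
  have hcard (m : ℕ) : Nat.card (Fin m → ZMod 2) = 2 ^ m := by simp
  have hpow : 2 ^ n = 2 ^ (n - k) * 2 ^ k := by rw [← pow_add, Nat.sub_add_cancel hk]
  obtain ⟨K, hK, Λ, hΛ, hfid⟩ := exists_isLOCC_le_maxEntangledFidelity_shiftMixture (ZMod 2)
    (Fin (n - k) → ZMod 2) hnonneg
  rw [hcard, hcard, hpow] at hK
  refine ⟨K, Nat.le_of_mul_le_mul_left hK (by positivity), Λ, hΛ, ?_⟩
  rw [copies_shiftMixture]
  refine le_trans (le_of_eq ?_) hfid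
  have hsqrt : ∑ e : Fin n → ZMod 2, √(∏ i, flipProb t (e i)) = (∑ e, √(flipProb t e)) ^ n := by
    simp only [Real.sqrt_prod _ fun _ _ => flipProb_nonneg h0 h1 _, Fintype.sum_pow]
  have hpow' : (2 : ℝ) ^ n = 2 ^ (n - k) * 2 ^ k := by exact_mod_cast hpow
  rw [← Fintype.sum_pow, sum_flipProb, one_pow, hsqrt, pow_right_comm, sum_sqrt_flipProb_sq h0 h1,
    hcard, div_pow, hpow', Nat.cast_pow, Nat.cast_ofNat]
  field_simp

open Filter Topology in
theorem exists_tendsto_two_pow_ceil_mul_pow {μ : ℝ} (h0 : 0 ≤ μ) (h1 : μ < 1) :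
    ∃ R ∈ Set.Ioc (0 : ℝ) 1, Tendsto (fun n : ℕ => 2 ^ ⌈R * n⌉₊ * μ ^ n) atTop (𝓝 0) := by
  have hcont : Tendsto (fun R : ℝ => (2 : ℝ) ^ R * μ) (𝓝[>] 0) (𝓝 μ) := by
    have h : ContinuousAt (fun R : ℝ => (2 : ℝ) ^ R * μ) 0 := by fun_prop (disch := norm_num)
    simpa using h.tendsto.mono_left nhdsWithin_le_nhds
  obtain ⟨R, hμ, hR⟩ := ((hcont.eventually_lt_const h1).and (Ioc_mem_nhdsGT one_pos)).exists
  refine ⟨R, hR, squeeze_zero (fun n => by positivity) (fun n => ?_)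
    (by simpa using (tendsto_pow_atTop_nhds_zero_of_lt_one (by positivity) hμ).const_mul 2)⟩
  have hceil : (2 : ℝ) ^ ⌈R * n⌉₊ ≤ 2 * ((2 : ℝ) ^ R) ^ n := by
    have hRn : 0 ≤ R * n := mul_nonneg hR.1.le n.cast_nonneg
    rw [← Real.rpow_natCast, ← Real.rpow_natCast, ← Real.rpow_mul zero_le_two, mul_comm 2,
      ← Real.rpow_add_one two_ne_zero]
    exact Real.rpow_le_rpow_of_exponent_le one_le_two (Nat.ceil_lt_add_one hRn).le
  calc (2 : ℝ) ^ ⌈R * n⌉₊ * μ ^ n ≤ 2 * ((2 : ℝ) ^ R) ^ n * μ ^ n := by gcongr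
    _ = 2 * ((2 : ℝ) ^ R * μ) ^ n := by rw [mul_pow, mul_assoc]

theorem isDistillable_of_isLOCC_dephased {A B : Type} [Finite A] [Finite B]
    {ρ : Matrix (A × B) (A × B) ℂ} {t : ℝ} (ht : t ∈ Set.Ioc (0 : ℝ) 1)
    {Λ : Matrix (A × B) (A × B) ℂ → Matrix (Fin 2 × Fin 2) (Fin 2 × Fin 2) ℂ} (hΛ : IsLOCC Λ)
    (hρ : Λ ρ = dephased t) : IsDistillable ρ := by
  have hrotate := (isLOCC_localConj conjTranspose_hadamard_mul_hadamard
    conjTranspose_hadamard_mul_hadamard).comp hΛ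
  have hsqrt : √(1 - t ^ 2) < 1 := by
    rw [Real.sqrt_lt' one_pos]
    linarith [pow_pos ht.1 2]
  obtain ⟨R, hR, hlim⟩ := exists_tendsto_two_pow_ceil_mul_pow (μ := (1 + √(1 - t ^ 2)) / 2)
    (by positivity) (by linarith)
  refine ⟨R, hR.1, fun ε hε => ?_⟩
  filter_upwards [hlim.eventually_le_const hε] with n hn
  have hk : ⌈R * n⌉₊ ≤ n := Nat.ceil_le.mpr (mul_le_of_le_one_left n.cast_nonneg hR.2)
  obtain ⟨Λ₁, hΛ₁, hcopies⟩ := hrotate.exists_copies n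
  obtain ⟨K, hK, Λ₂, hΛ₂, hfid⟩ :=
    exists_isLOCC_le_maxEntangledFidelity_copies ht.1.le ht.2 hk
  refine ⟨K, ?_, _, hΛ₂.comp hΛ₁, ?_⟩
  · calc (2 : ℝ) ^ (R * n) ≤ 2 ^ (⌈R * n⌉₊ : ℝ) :=
          Real.rpow_le_rpow_of_exponent_le one_le_two (Nat.le_ceil _)
      _ = (2 ^ ⌈R * n⌉₊ : ℕ) := by rw [Real.rpow_natCast, Nat.cast_pow, Nat.cast_ofNat]
      _ ≤ K := Nat.cast_le.mpr hK
  · rw [hcopies, hρ, localConj_hadamard_dephased]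
    exact (sub_le_sub_left hn 1).trans hfid

end

end Bipartite

theorem mainTheorem5 {A B : Type} [Fintype A] [Fintype B] [DecidableEq A] [DecidableEq B]
    (ρ : Matrix (A × B) (A × B) ℂ) (hpair : Bipartite.IsPairing ρ)
    (hent : Bipartite.IsEntangled ρ) :
    Bipartite.IsNPT ρ ∧ Bipartite.IsDistillable ρ := by
  obtain ⟨hρ, UA, hA, UB, hB, hneg⟩ := hpair
  set σ := Bipartite.localConj UA UB ρ
  have hσ : Bipartite.IsState σ := hρ.localConj hA hB
  have hpairing : Bipartite.negativity σ = Bipartite.l1Coherence σ :=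
    (Bipartite.negativity_localConj hA hB ρ).trans hneg
  have hdiag : ¬ σ.IsDiag := fun hd => hent.2 <| by
    rw [← Bipartite.localConj_star_localConj hA hB ρ]
    exact (Bipartite.isSeparable_of_isDiag hσ hd).localConj (Unitary.star_mem hA)
      (Unitary.star_mem hB)
  simp only [Matrix.IsDiag, Pairwise, not_forall] at hdiag
  obtain ⟨⟨a, b⟩, ⟨a', b'⟩, hne, hcoh⟩ := hdiag
  obtain ⟨hpop, hpop'⟩ :=
    Bipartite.apply_swap_eq_zero_of_negativity_eq_l1Coherence hσ hpairing hne hcoh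
  refine ⟨Bipartite.isNPT_of_isNPT_localConj (Bipartite.isNPT_of_apply_ne_zero hcoh hpop'), ?_⟩
  obtain ⟨t, ht, Λ, hΛ, hdephased⟩ := Bipartite.exists_isLOCC_dephased hσ hcoh hpop hpop'
  exact Bipartite.isDistillable_of_isLOCC_dephased ht
    (hΛ.comp (Bipartite.isLOCC_localConj (Matrix.mem_unitaryGroup_iff'.mp hA)
      (Matrix.mem_unitaryGroup_iff'.mp hB))) hdephased
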